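/- **Theorem 1.2.** The twist-invariant orientability type $\mathrm{tot}$ of a dessin d'enfant is independent of its monodromy group, point stabilisers and automorphism group (as abstract groups) and of its passport. More precisely: *Conventions.* A dessin with (finite, non-empty) edge set $E$ is given by two permutations $\sigma_0,\sigma_1$ of $E$ (the rotations of edges around white and black vertices) generating a transitive group, its monodromy group; put $\sigma_\infty=(\sigma_0\sigma_1)^{-1}$. The white vertices, black vertices and faces are the cycles of $\sigma_0,\sigma_1,\sigma_\infty$, their degrees are the cycle lengths, the passport is the triple of multisets of these degrees, and the type is the triple $(a,b,c)$ of their least common multiples. The dessin is uniform if all white vertices have degree $a$, all black vertices degree $b$ and all faces degree $c$. The automorphism group consists of the permutations of $E$ commuting with $\sigma_0$ and $\sigma_1$. The dessin is Z-orientable if its faces can be labelled $+$ or $-$ so that each edge is incident with faces having different labels. If $\mathcal D$ corresponds to $(\sigma_0,\sigma_1,\sigma_\infty)$, let $\mathcal D'$ and $\mathcal D''$ correspond to $(\sigma_1,\sigma_\infty,\sigma_0)$ and $(\sigma_\infty,\sigma_0,\sigma_1)$; then $\mathrm{tot}(\mathcal D)$ is the number of Z-orientable dessins in the triple $\mathcal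 D,\mathcal D',\mathcal D''$. *The two groups of the cube.* Let $Q$ be the group of permutations of the six faces of a cube induced by its rotations, and $P$ the group of those induced by the isometries of the cube preserving each of its two inscribed regular tetrahedra. Then $P\cong S_4\cong Q$, but $P$ and $Q$ are not conjugate in the group $S_6$ of all permutations of the six faces. *The dessins.* Let $n\ge 8$, and let $A$ and $B$ be subgroups of $S_n$ acting as $P$ and $Q$, respectively, on the same set of six points, identified with the faces of the cube, and fixing the remaining $n-6$ points. Put $M=S_n\times S_n$ and $$H_0=B\times B,\quad H_1=B\times A,\quad H_2=A\times B,\quad H_3=A\times A .$$ Then there are elements $m_0,m_1$ generating $M$ such that the four dessins $\mathcal D_i$ $(i=0,1,2,3)$, whose edges are the cosets of $H_i$ in $M$ and whose permutations $\sigma_0,\sigma_1$ are induced by $m_0,m_1$, have the following properties: 1. the subgroups $H_0,H_1,H_2,H_3$ are pairwise non-conjugate in $M$; 2. each $\mathcal D_i$ has degree $(n!/4!)^2$ and is uniform, and all four have the same type and the same passport; 3. each $\mathcal D_i$ has monodromy group isomorphic to $S_n\times S_n$, edge stabilisers (in the monodromy group) isomorphic to $S_4\times S_4$, and automorphism group isomorphic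 to $(S_2\times S_{n-6})\times(S_2\times S_{n-6})$; 4. $\mathrm{tot}(\mathcal D_0)=0$, $\mathrm{tot}(\mathcal D_1)=\mathrm{tot}(\mathcal D_2)=1$ and $\mathrm{tot}(\mathcal D_3)=3$; 5. $\mathcal D_2$ is Z-orientable and $\mathcal D_1$ is not. -/

import Mathlib

/-!
# Dessins d'enfants through their permutation representations

A dessin d'enfant with edge set `E` is a pair of permutations `σ₀`, `σ₁` of `E`, giving the
cyclic order of the edges around the white and around the black vertices, and generating a
transitive group (the bipartite graph is connected).  The white vertices, black vertices and
faces are the cycles of `σ₀`, `σ₁` and `σ∞ = (σ₀ σ₁)⁻¹`, cycles of length one included.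
Permutations are composed as functions.
-/

open Equiv

/-- A dessin d'enfant with edge set `E`, as a transitive pair of permutations. -/
structure Dessin (E : Type*) where
  /-- The rotation of the edges around the white vertices. -/
  σ₀ : Perm E
  /-- The rotation of the edges around the black vertices. -/
  σ₁ : Perm E
  finite : Finite E
  nonempty : Nonempty E
  transitive : MulAction.IsPretransitive (Subgroup.closure {σ₀, σ₁}) E

/-- The cycles of a permutation `σ`, including those of length one. -/
abbrev CycleOf {E : Type*} (σ : Perm E) : Type _ := Quotient (Perm.SameCycle.setoid σ)

/-- The cycle of `σ` containing `e`. -/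
abbrev toCycle {E : Type*} (σ : Perm E) (e : E) : CycleOf σ :=
  Quotient.mk (Perm.SameCycle.setoid σ) e

/-- The multiset of the lengths of the cycles of `σ`, including those of length one. -/
noncomputable def cycleLengths {E : Type*} [Finite E] (σ : Perm E) : Multiset ℕ :=
  letI : Fintype (CycleOf σ) := Fintype.ofFinite _
  (Finset.univ : Finset (CycleOf σ)).val.map fun v => Nat.card {e : E // toCycle σ e = v}

namespace Dessin

variable {E : Type*}

/-- The monodromy at infinity, determined by `σ₀ σ₁ σ∞ = 1`. -/
def σinf (D : Dessin E) : Perm E := (D.σ₀ * D.σ₁)⁻¹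

/-- The faces are the cycles of `σ∞`. -/
abbrev Face (D : Dessin E) : Type _ := CycleOf D.σinf

/-- The number of edges. -/
noncomputable def degree (_D : Dessin E) : ℕ := Nat.card E

/-- The passport: the degrees of the white vertices, of the black vertices and of the faces. -/
noncomputable def passport (D : Dessin E) : Multiset ℕ × Multiset ℕ × Multiset ℕ :=
  haveI := D.finite
  (cycleLengths D.σ₀, cycleLengths D.σ₁, cycleLengths D.σinf)

/-- The type: the least common multiples of the degrees of the white vertices, of the black
vertices and of the faces. -/
noncomputable def type (D : Dessin E) : ℕ × ℕ × ℕ :=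
  (D.passport.1.lcm, D.passport.2.1.lcm, D.passport.2.2.lcm)

/-- A dessin of type `(a, b, c)` is uniform if all white vertices have degree `a`, all black
vertices have degree `b` and all faces have degree `c`. -/
def IsUniform (D : Dessin E) : Prop :=
  (∀ d ∈ D.passport.1, d = D.type.1) ∧ (∀ d ∈ D.passport.2.1, d = D.type.2.1) ∧
    ∀ d ∈ D.passport.2.2, d = D.type.2.2

/-- The monodromy group, generated by `σ₀` and `σ₁`. -/
def monodromyGroup (D : Dessin E) : Subgroup (Perm E) := Subgroup.closure {D.σ₀, D.σ₁}

/-- The stabiliser of the edge `e` in the monodromy group. -/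
def edgeStabilizer (D : Dessin E) (e : E) : Subgroup D.monodromyGroup :=
  MulAction.stabilizer D.monodromyGroup e

/-- The automorphism group: the permutations of the edges commuting with `σ₀` and `σ₁`. -/
def automorphismGroup (D : Dessin E) : Subgroup (Perm E) := Subgroup.centralizer {D.σ₀, D.σ₁}

/-- The face on one side of the edge `e`. -/
def rightFace (D : Dessin E) (e : E) : D.Face := toCycle D.σinf e

/-- The face on the other side of the edge `e`.  The corner between `e` and `σ₀ e` at the white
vertex of `e` lies between these two edges, so the far side of `e` is the near side of `σ₀ e`. -/
def leftFace (D : Dessin E) (e : E) : D.Face := toCycle D.σinf (D.σ₀ e)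

/-- A dessin is Z-orientable if its faces can be labelled with two signs in such a way that each
edge is incident with faces having different labels. -/
def IsZOrientable (D : Dessin E) : Prop :=
  ∃ label : D.Face → ℤˣ, ∀ e : E, label (D.leftFace e) ≠ label (D.rightFace e)

/-- The twisted dessin `D'`, which replaces `(σ₀, σ₁, σ∞)` with `(σ₁, σ∞, σ₀)`. -/
def twist (D : Dessin E) : Dessin E where
  σ₀ := D.σ₁
  σ₁ := D.σinf
  finite := D.finite
  nonempty := D.nonempty
  transitive := by
    have h : Subgroup.closure {D.σ₁, D.σinf} = Subgroup.closure {D.σ₀, D.σ₁} := by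
      apply le_antisymm
      · rw [Subgroup.closure_le]
        have h0 : D.σ₀ ∈ Subgroup.closure {D.σ₀, D.σ₁} := Subgroup.subset_closure (by simp)
        have h1 : D.σ₁ ∈ Subgroup.closure {D.σ₀, D.σ₁} := Subgroup.subset_closure (by simp)
        rintro x (rfl | rfl)
        · exact h1
        · exact inv_mem (mul_mem h0 h1)
      · rw [Subgroup.closure_le]
        have h1 : D.σ₁ ∈ Subgroup.closure {D.σ₁, D.σinf} := Subgroup.subset_closure (by simp)
        have h2 : D.σinf ∈ Subgroup.closure {D.σ₁, D.σinf} := Subgroup.subset_closure (by simp)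
        rintro x (rfl | rfl)
        · have h3 := mul_mem (inv_mem h2) (inv_mem h1)
          simpa [σinf] using h3
        · exact h1
    rw [h]
    exact D.transitive

/-- The twist-invariant orientability type: the number of Z-orientable dessins among the triple
`D`, `D'`, `D''`. -/
noncomputable def tot (D : Dessin E) : ℕ :=
  Nat.card {k : Fin 3 // (twist^[k.val] D).IsZOrientable}

/-- The dessin of the tuple `(M, H, m₀, m₁, (m₀ m₁)⁻¹)`: the edges are the cosets of `H` in the
finite group `M`, and `σ₀`, `σ₁` are the permutations induced by the generators `m₀`, `m₁`. -/
def ofCosets {M : Type*} [Group M] [Finite M] (H : Subgroup M) (m₀ m₁ : M)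
    (hgen : Subgroup.closure {m₀, m₁} = ⊤) : Dessin (M ⧸ H) where
  σ₀ := MulAction.toPermHom M (M ⧸ H) m₀
  σ₁ := MulAction.toPermHom M (M ⧸ H) m₁
  finite := inferInstance
  nonempty := inferInstance
  transitive := by
    refine ⟨fun x y => ?_⟩
    obtain ⟨g, hg⟩ := MulAction.exists_smul_eq M x y
    have hmem : MulAction.toPermHom M (M ⧸ H) g ∈ Subgroup.closure
        {MulAction.toPermHom M (M ⧸ H) m₀, MulAction.toPermHom M (M ⧸ H) m₁} := by
      have h1 : g ∈ Subgroup.closure {m₀, m₁} := by simp [hgen]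
      have h2 := Subgroup.mem_map_of_mem (MulAction.toPermHom M (M ⧸ H)) h1
      rwa [MonoidHom.map_closure, Set.image_pair] at h2
    exact ⟨⟨_, hmem⟩, hg⟩

end Dessin

/-! ### The two transitive copies of `S₄` acting on the faces of a cube -/

/-- The faces of the cube `[-1, 1]³`: the pair `(k, s)` is the face with outward unit normal
`s e_k`. -/
abbrev CubeFace : Type := Fin 3 × ℤˣ

/-- The outward unit normal of a face. -/
def CubeFace.normal (f : CubeFace) : Fin 3 → ℤ := Pi.single f.1 (f.2 : ℤ)

/-- The isometry `g` of the cube induces the permutation `π` of its faces.  The isometries of the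
cube are the integral orthogonal matrices. -/
def CubeFace.Induces (g : Matrix.orthogonalGroup (Fin 3) ℤ) (π : Perm CubeFace) : Prop :=
  ∀ f : CubeFace, g.1.mulVec f.normal = (π f).normal

/-- The vertices of one of the two regular tetrahedra inscribed in the cube `[-1, 1]³`, the other
one consisting of the opposite vertices. -/
def inscribedTetrahedron : Set (Fin 3 → ℤ) := {v | (∀ k, v k = 1 ∨ v k = -1) ∧ ∏ k, v k = 1}

theorem CubeFace.induces_one : CubeFace.Induces 1 1 := by
  intro f; simp

theorem CubeFace.Induces.mul {g h : Matrix.orthogonalGroup (Fin 3) ℤ} {π ρ : Perm CubeFace}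
    (hg : CubeFace.Induces g π) (hh : CubeFace.Induces h ρ) :
    CubeFace.Induces (g * h) (π * ρ) := by
  intro f
  have h1 : (g * h).1 = g.1 * h.1 := rfl
  rw [h1, ← Matrix.mulVec_mulVec, hh f, hg (ρ f), Perm.mul_apply]

theorem orthogonal_inv_mulVec (g : Matrix.orthogonalGroup (Fin 3) ℤ) (v : Fin 3 → ℤ) :
    (g⁻¹).1.mulVec (g.1.mulVec v) = v := by
  have h1 : (g⁻¹).1 * g.1 = 1 := congrArg Subtype.val (inv_mul_cancel g)
  rw [Matrix.mulVec_mulVec, h1, Matrix.one_mulVec]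

theorem CubeFace.Induces.inv {g : Matrix.orthogonalGroup (Fin 3) ℤ} {π : Perm CubeFace}
    (hg : CubeFace.Induces g π) : CubeFace.Induces g⁻¹ π⁻¹ := by
  intro f
  have h1 := hg (π⁻¹ f)
  have h2 : π (π⁻¹ f) = f := Equiv.apply_symm_apply π f
  rw [h2] at h1
  rw [← h1, orthogonal_inv_mulVec]

/-- The group `Q` of permutations of the faces of the cube induced by its rotations. -/
def cubeRotations : Subgroup (Perm CubeFace) where
  carrier := {π | ∃ g : Matrix.orthogonalGroup (Fin 3) ℤ, CubeFace.Induces g π ∧ g.1.det = 1}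
  one_mem' := ⟨1, CubeFace.induces_one, by simp⟩
  mul_mem' := by
    rintro π ρ ⟨g, hg, dg⟩ ⟨h, hh, dh⟩
    refine ⟨g * h, hg.mul hh, ?_⟩
    have h1 : (g * h).1 = g.1 * h.1 := rfl
    rw [h1, Matrix.det_mul, dg, dh, one_mul]
  inv_mem' := by
    rintro π ⟨g, hg, dg⟩
    refine ⟨g⁻¹, hg.inv, ?_⟩
    have h1 : (g⁻¹).1 * g.1 = 1 := congrArg Subtype.val (inv_mul_cancel g)
    have h2 := congrArg Matrix.det h1
    rwa [Matrix.det_mul, dg, mul_one, Matrix.det_one] at h2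

/-- The group `P` of permutations of the faces of the cube induced by those isometries of the cube
which preserve each of the two inscribed tetrahedra (preserving one of them is enough, the other
one being its image under the antipodal map). -/
def cubeTetrahedral : Subgroup (Perm CubeFace) where
  carrier := {π | ∃ g : Matrix.orthogonalGroup (Fin 3) ℤ, CubeFace.Induces g π ∧
    ∀ v, g.1.mulVec v ∈ inscribedTetrahedron ↔ v ∈ inscribedTetrahedron}
  one_mem' := ⟨1, CubeFace.induces_one, by simp⟩
  mul_mem' := by
    rintro π ρ ⟨g, hg, dg⟩ ⟨h, hh, dh⟩
    refine ⟨g * h, hg.mul hh, fun v => ?_⟩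
    have h1 : (g * h).1 = g.1 * h.1 := rfl
    rw [h1, ← Matrix.mulVec_mulVec, dg, dh]
  inv_mem' := by
    rintro π ⟨g, hg, dg⟩
    refine ⟨g⁻¹, hg.inv, fun v => ?_⟩
    have h1 := orthogonal_inv_mulVec g⁻¹ v
    rw [inv_inv] at h1
    rw [← dg, h1]

/-- The copy of `P` in `Sₙ` acting on six points `ι f` as `P` acts on the faces of the cube, and
fixing all the other points. -/
noncomputable def tetrahedralIn {n : ℕ} (ι : CubeFace ↪ Fin n) : Subgroup (Perm (Fin n)) :=
  cubeTetrahedral.map (Perm.viaEmbeddingHom ι)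

/-- The copy of `Q` in `Sₙ` acting on six points `ι f` as `Q` acts on the faces of the cube, and
fixing all the other points. -/
noncomputable def rotationsIn {n : ℕ} (ι : CubeFace ↪ Fin n) : Subgroup (Perm (Fin n)) :=
  cubeRotations.map (Perm.viaEmbeddingHom ι)

/-- The four subgroups `B × B`, `B × A`, `A × B`, `A × A` of `Sₙ × Sₙ`, where `A` and `B` are the
copies of `P` and `Q`. -/
noncomputable def cubeStabilizer {n : ℕ} (ι : CubeFace ↪ Fin n) :
    Fin 4 → Subgroup (Perm (Fin n) × Perm (Fin n)) :=
  ![(rotationsIn ι).prod (rotationsIn ι), (rotationsIn ι).prod (tetrahedralIn ι),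
    (tetrahedralIn ι).prod (rotationsIn ι), (tetrahedralIn ι).prod (tetrahedralIn ι)]

/-!
If `m₀` and `m₁` generate `M` and `θ : M → {1, -1}` is a character with `θ m₀ = θ m₁ = -1`, a
labelling of the faces of the dessin of `(M, H)` is a sign function on `M ⧸ H` which each `g`
multiplies by `θ g`; it exists exactly when `H ≤ ker θ`.  Take `m₀ = (x, z)` and `m₁ = (y, x)` with
`x y z = 1`, where `x`, `y` are odd and generate `Sₙ`, and their orders are prime to that of the
even `z`; then `m₀` and `m₁` generate `Sₙ × Sₙ`.  For a product `T × T'` of subgroups of `Sₙ`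
the three characters `sgn₁`, `sgn₂`, `sgn₁ sgn₂` then decide the Z-orientability of the dessin and
of its two twists.  As `P` is even and `Q` is not, this gives the values of `tot`, and, since
kernels are normal, the non-conjugacy statements.

If moreover `x`, `y`, `z` are cycles fixing at most one of the `n ≥ 8` points, no conjugate of a
non-trivial power lies in a subgroup moving only six points.  Hence `m₀`, `m₁`, `m∞` act
semiregularly on the cosets, and the passport depends only on the index.

As signed permutations of the three axes, `P` and `Q` are kernels of two characters which take the
value `-1` at the antipodal map and `1` at the half turns.  So both are complements of the
antipodal map in the group of the cube.  The half turns, each fixing exactly two opposite faces,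
show that this group is their normaliser in `S₆`, and the quotient of the normaliser gives the
automorphism group.
-/

/-! ### Semiregular generators and passports -/

theorem card_toCycle_fiber {E : Type*} [Finite E] (σ : Perm E) (e : E) :
    Nat.card {e' : E // toCycle σ e' = toCycle σ e} = MulAction.period σ e := by
  have : Fintype (MulAction.orbit (Subgroup.zpowers σ) e) := Fintype.ofFinite _
  rw [MulAction.period_eq_minimalPeriod, MulAction.minimalPeriod_eq_card,
    ← Nat.card_eq_fintype_card]
  refine Nat.card_congr (Equiv.subtypeEquivRight fun e' => ?_)
  rw [Quotient.eq_iff_equiv]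
  constructor
  · intro h
    obtain ⟨i, hi⟩ := Perm.SameCycle.symm h
    exact ⟨⟨σ ^ i, i, rfl⟩, hi⟩
  · rintro ⟨⟨_, i, rfl⟩, hi⟩
    exact Perm.SameCycle.symm ⟨i, hi⟩

theorem cycleLengths_eq_replicate {E : Type*} [Finite E] {σ : Perm E} {o : ℕ} (ho : 0 < o)
    (h : ∀ e : E, MulAction.period σ e = o) :
    cycleLengths σ = Multiset.replicate (Nat.card E / o) o := by
  let _ : Fintype (CycleOf σ) := Fintype.ofFinite _
  have hfiber : ∀ v : CycleOf σ, Nat.card {e : E // toCycle σ e = v} = o :=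
    Quotient.ind fun e => (card_toCycle_fiber σ e).trans (h e)
  have hcard : Nat.card E = Nat.card (CycleOf σ) * o := by
    rw [Nat.card_congr (Equiv.sigmaFiberEquiv (toCycle σ)).symm, Nat.card_sigma,
      Finset.sum_congr rfl fun v _ => hfiber v, Finset.sum_const, Finset.card_univ,
      Nat.card_eq_fintype_card, smul_eq_mul]
  rw [hcard, Nat.mul_div_cancel _ ho, Nat.card_eq_fintype_card]
  exact (Multiset.map_congr rfl fun v _ => hfiber v).trans (Multiset.map_const' _ _)

theorem lcm_replicate_of_ne_zero {k : ℕ} (hk : k ≠ 0) (o : ℕ) :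
    (Multiset.replicate k o).lcm = o :=
  Nat.dvd_antisymm (Multiset.lcm_dvd.2 fun _ hd => (Multiset.eq_of_mem_replicate hd).dvd)
    (Multiset.dvd_lcm (Multiset.mem_replicate.2 ⟨hk, rfl⟩))

/-- An element of a group acting on `X` is semiregular if only the trivial one among its powers
has a fixed point, that is, if all its cycles on `X` have length `orderOf g`. -/
def IsSemiregular {M : Type*} [Group M] (X : Type*) [MulAction M X] (g : M) : Prop :=
  ∀ (k : ℕ) (x : X), g ^ k • x = x → g ^ k = 1

namespace IsSemiregular

variable {M X : Type*} [Group M] [MulAction M X] {g : M}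

theorem period_eq (hg : IsSemiregular X g) (x : X) : MulAction.period g x = orderOf g :=
  Nat.dvd_antisymm (MulAction.period_dvd_orderOf g x)
    (orderOf_dvd_of_pow_eq_one (hg _ x (MulAction.pow_period_smul g x)))

theorem cycleLengths_toPermHom [Finite M] [Finite X] (hg : IsSemiregular X g) :
    cycleLengths (MulAction.toPermHom M X g) =
      Multiset.replicate (Nat.card X / orderOf g) (orderOf g) :=
  cycleLengths_eq_replicate (orderOf_pos g) hg.period_eq

theorem quotient_prod {G G' : Type*} [Group G] [Group G'] {A : Subgroup G} {B : Subgroup G'}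
    {a : G} {b : G'} (ha : IsSemiregular (G ⧸ A) a) (hb : IsSemiregular (G' ⧸ B) b) :
    IsSemiregular ((G × G') ⧸ A.prod B) (a, b) := by
  intro k q hq
  induction q using QuotientGroup.induction_on with
  | H x =>
    have hmem := Subgroup.mem_prod.1 (QuotientGroup.eq.1 hq)
    exact Prod.ext (ha k x.1 (QuotientGroup.eq.2 hmem.1)) (hb k x.2 (QuotientGroup.eq.2 hmem.2))

theorem of_isCycle {α : Type*} [DecidableEq α] [Fintype α] {σ : Perm α} (hσ : σ.IsCycle)
    {A : Subgroup (Perm α)} (hA : ∀ τ ∈ A, τ.support.card < σ.support.card) :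
    IsSemiregular (Perm α ⧸ A) σ := by
  intro k q hq
  by_contra hne
  induction q using QuotientGroup.induction_on with
  | H τ =>
    have hmem : (τ⁻¹ * σ ^ k * τ⁻¹⁻¹)⁻¹ ∈ A := by
      simpa [mul_assoc] using QuotientGroup.eq.1 hq
    have hsupp : (σ ^ k).support = σ.support :=
      hσ.support_pow_eq_iff.2 fun hdvd => hne (orderOf_dvd_iff_pow_eq_one.1 hdvd)
    have hlt := hA _ hmem
    rw [Perm.support_inv, Perm.card_support_conj, hsupp] at hlt
    exact lt_irrefl _ hlt

end IsSemiregular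

namespace Dessin

section Passport

variable {E F : Type*} {D : Dessin E} {D' : Dessin F}

theorem isUniform_of_passport {a b c i j k : ℕ}
    (h : D.passport =
      (Multiset.replicate i a, Multiset.replicate j b, Multiset.replicate k c)) :
    D.IsUniform := by
  have eq_lcm (i a d : ℕ) (hd : d ∈ Multiset.replicate i a) :
      d = (Multiset.replicate i a).lcm := by
    rw [Multiset.mem_replicate] at hd
    rw [lcm_replicate_of_ne_zero hd.1, hd.2]
  unfold IsUniform type
  rw [h]
  exact ⟨eq_lcm _ _, eq_lcm _ _, eq_lcm _ _⟩

theorem type_eq_of_passport_eq (h : D.passport = D'.passport) : D.type = D'.type := by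
  unfold type; rw [h]

end Passport

section Cosets

variable {M : Type*} [Group M] [Finite M] (H : Subgroup M) {m₀ m₁ : M}
  (hgen : Subgroup.closure {m₀, m₁} = ⊤)

theorem ofCosets_σinf : (ofCosets H m₀ m₁ hgen).σinf =
    MulAction.toPermHom M (M ⧸ H) (m₀ * m₁)⁻¹ := by
  rw [map_inv, map_mul]; rfl

theorem passport_ofCosets (h₀ : IsSemiregular (M ⧸ H) m₀) (h₁ : IsSemiregular (M ⧸ H) m₁)
    (h₂ : IsSemiregular (M ⧸ H) (m₀ * m₁)⁻¹) :
    (ofCosets H m₀ m₁ hgen).passport =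
      (Multiset.replicate (H.index / orderOf m₀) (orderOf m₀),
        Multiset.replicate (H.index / orderOf m₁) (orderOf m₁),
        Multiset.replicate (H.index / orderOf (m₀ * m₁)⁻¹) (orderOf (m₀ * m₁)⁻¹)) := by
  refine Prod.ext h₀.cycleLengths_toPermHom (Prod.ext h₁.cycleLengths_toPermHom ?_)
  change cycleLengths (ofCosets H m₀ m₁ hgen).σinf = _
  rw [ofCosets_σinf]
  exact h₂.cycleLengths_toPermHom

end Cosets

end Dessin

/-! ### Z-orientability of coset dessins -/

theorem closure_pair_twist {M : Type*} [Group M] (m₀ m₁ : M) :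
    Subgroup.closure {m₁, (m₀ * m₁)⁻¹} = Subgroup.closure {m₀, m₁} := by
  have hmem (a b : M) : a ∈ Subgroup.closure {a, b} ∧ b ∈ Subgroup.closure {a, b} :=
    ⟨Subgroup.subset_closure (by simp), Subgroup.subset_closure (by simp)⟩
  obtain ⟨h₀, h₁⟩ := hmem m₀ m₁
  obtain ⟨h₁', hinf⟩ := hmem m₁ (m₀ * m₁)⁻¹
  refine le_antisymm (Subgroup.closure_le _ |>.2 ?_) (Subgroup.closure_le _ |>.2 ?_)
  · rintro x (rfl | rfl)
    exacts [h₁, inv_mem (mul_mem h₀ h₁)]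
  · rintro x (rfl | rfl)
    exacts [by simpa using mul_mem (inv_mem hinf) (inv_mem h₁'), h₁']

theorem prod_le_ker_coprod {G G' : Type*} [Group G] [Group G'] {A : Subgroup G} {B : Subgroup G'}
    {χ : G →* ℤˣ} {χ' : G' →* ℤˣ} :
    A.prod B ≤ (χ.coprod χ').ker ↔ A ≤ χ.ker ∧ B ≤ χ'.ker := by
  rw [Subgroup.prod_le_iff, Subgroup.map_le_iff_le_comap, Subgroup.map_le_iff_le_comap,
    MonoidHom.comap_ker, MonoidHom.comap_ker, MonoidHom.coprod_comp_inl,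
    MonoidHom.coprod_comp_inr]

namespace Dessin

variable {E : Type*}

-- The signs of the faces are recorded on the edges on their near sides; being constant on the
-- cycles of `σ∞` then says that the product `σ₀ σ₁` preserves the sign.
theorem isZOrientable_iff (D : Dessin E) : D.IsZOrientable ↔
    ∃ ε : E → ℤˣ, (∀ e, ε (D.σ₀ e) = -ε e) ∧ ∀ e, ε (D.σ₁ e) = -ε e := by
  constructor
  · rintro ⟨label, hlabel⟩
    have h₀ (e : E) : label (toCycle D.σinf (D.σ₀ e)) = -label (toCycle D.σinf e) :=
      Int.units_ne_iff_eq_neg.1 (hlabel e)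
    refine ⟨fun e => label (toCycle D.σinf e), h₀, fun e => ?_⟩
    have hcycle : toCycle D.σinf (D.σ₀ (D.σ₁ e)) = toCycle D.σinf e :=
      Quotient.sound ⟨1, D.σinf.apply_symm_apply e⟩
    beta_reduce
    rw [← hcycle, h₀, neg_neg]
  · rintro ⟨ε, h₀, h₁⟩
    have hinf (e : E) : ε (D.σinf e) = ε e := by
      conv_rhs => rw [← D.σinf.symm_apply_apply e]
      change ε (D.σinf e) = ε (D.σ₀ (D.σ₁ (D.σinf e)))
      rw [h₀, h₁, neg_neg]
    have hpow (k : ℕ) (e : E) : ε ((D.σinf ^ k) e) = ε e := by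
      induction k with
      | zero => rfl
      | succ k ih => rw [pow_succ', Perm.mul_apply, hinf, ih]
    have := D.finite
    refine ⟨Quotient.lift ε fun a b hab => ?_, fun e => Int.units_ne_iff_eq_neg.2 (h₀ e)⟩
    obtain ⟨k, -, rfl⟩ := Perm.SameCycle.exists_nat_pow_eq hab
    exact (hpow k a).symm

open Classical in
theorem tot_eq (D : Dessin E) : D.tot = (if D.IsZOrientable then 1 else 0) +
    (if D.twist.IsZOrientable then 1 else 0) + if D.twist.twist.IsZOrientable then 1 else 0 := by
  rw [tot, Nat.card_eq_fintype_card, Fintype.card_subtype, Finset.card_filter,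
    Fin.sum_univ_three]
  rfl

section Cosets

variable {M : Type*} [Group M] [Finite M] (H : Subgroup M) {m₀ m₁ : M}
  (hgen : Subgroup.closure {m₀, m₁} = ⊤)

theorem twist_ofCosets : (ofCosets H m₀ m₁ hgen).twist =
    ofCosets H m₁ (m₀ * m₁)⁻¹ ((closure_pair_twist m₀ m₁).trans hgen) := by
  have h := ofCosets_σinf H hgen
  unfold twist
  congr 1

-- A sign function reversed by both generators is determined by its value at the trivial coset:
-- it is multiplied by `θ g` under every `g`.
theorem isZOrientable_ofCosets_iff {θ : M →* ℤˣ} (h₀ : θ m₀ = -1) (h₁ : θ m₁ = -1) :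
    (ofCosets H m₀ m₁ hgen).IsZOrientable ↔ H ≤ θ.ker := by
  rw [isZOrientable_iff]
  constructor
  · rintro ⟨ε, hε₀, hε₁⟩ h hh
    have hsmul (g : M) : ∀ e : M ⧸ H, ε (g • e) = θ g * ε e := by
      induction (hgen ▸ Subgroup.mem_top g : g ∈ Subgroup.closure {m₀, m₁}) using
        Subgroup.closure_induction with
      | mem x hx =>
        rcases hx with rfl | rfl
        exacts [fun e => by rw [h₀, neg_one_mul]; exact hε₀ e,
          fun e => by rw [h₁, neg_one_mul]; exact hε₁ e]
      | one => simp
      | mul x y _ _ ihx ihy => intro e; rw [mul_smul, ihx, ihy, map_mul, mul_assoc]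
      | inv x _ ih => intro e; rw [map_inv, eq_inv_mul_iff_mul_eq, ← ih, smul_inv_smul]
    have hfix : h • ((1 : M) : M ⧸ H) = (1 : M) := by
      rw [MulAction.Quotient.smul_mk, QuotientGroup.eq]
      simpa using hh
    have hmul := hsmul h (1 : M)
    rw [hfix] at hmul
    exact MonoidHom.mem_ker.2 (right_eq_mul.1 hmul)
  · intro hH
    refine ⟨Quotient.lift θ fun a b hab => ?_, ?_, ?_⟩
    · exact inv_mul_eq_one.1 (by simpa using hH (QuotientGroup.leftRel_apply.1 hab))
    · refine Quotient.ind fun g => ?_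
      change θ (m₀ * g) = -θ g
      rw [map_mul, h₀, neg_one_mul]
    · refine Quotient.ind fun g => ?_
      change θ (m₁ * g) = -θ g
      rw [map_mul, h₁, neg_one_mul]

end Cosets

section Prod

variable {G G' : Type*} [Group G] [Group G'] [Finite G] [Finite G'] (A : Subgroup G)
  (B : Subgroup G') {χ : G →* ℤˣ} {χ' : G' →* ℤˣ} {m₀ m₁ : G × G'}
  (hgen : Subgroup.closure {m₀, m₁} = ⊤)

theorem isZOrientable_ofCosets_prod (h₀ : χ m₀.1 = -1) (h₁ : χ m₁.1 = -1) :
    (ofCosets (A.prod B) m₀ m₁ hgen).IsZOrientable ↔ A ≤ χ.ker := by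
  rw [isZOrientable_ofCosets_iff (θ := χ.coprod 1) _ _ (by simp [h₀]) (by simp [h₁]),
    prod_le_ker_coprod]
  simp

-- The characters `χ`, `χ'` and `χ χ'` of the product take the value `-1` at `m₀` and `m₁`, at
-- `m₁` and `m∞`, and at `m∞` and `m₀`, respectively.
open Classical in
theorem tot_ofCosets_prod (h₀ : χ m₀.1 = -1) (h₀' : χ' m₀.2 = 1) (h₁ : χ m₁.1 = -1)
    (h₁' : χ' m₁.2 = -1) :
    (ofCosets (A.prod B) m₀ m₁ hgen).tot = (if A ≤ χ.ker then 1 else 0) +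
      (if B ≤ χ'.ker then 1 else 0) + if A ≤ χ.ker ∧ B ≤ χ'.ker then 1 else 0 := by
  have h' : (ofCosets (A.prod B) m₀ m₁ hgen).twist.IsZOrientable ↔ B ≤ χ'.ker := by
    rw [twist_ofCosets, isZOrientable_ofCosets_iff (θ := MonoidHom.coprod 1 χ') _ _
      (by simp [h₁']) (by simp [h₀', h₁']), prod_le_ker_coprod]
    simp
  have h'' : (ofCosets (A.prod B) m₀ m₁ hgen).twist.twist.IsZOrientable ↔
      A ≤ χ.ker ∧ B ≤ χ'.ker := by
    rw [twist_ofCosets, twist_ofCosets, isZOrientable_ofCosets_iff (θ := χ.coprod χ') _ _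
      (by simp [h₀, h₁, h₀', h₁']) (by simp [h₀, h₀']), prod_le_ker_coprod]
  simp only [tot_eq, isZOrientable_ofCosets_prod A B hgen h₀ h₁, h', h'']

end Prod

end Dessin

/-! ### Monodromy and automorphism groups of coset dessins -/

section RightTranslation

variable {G : Type*} [Group G] (H : Subgroup G)

/-- The action of the normaliser of `H` on the cosets `gH` by right translations; the inverse
makes this left action a homomorphism. -/
def rightTranslation : Subgroup.normalizer (H : Set G) →* Perm (G ⧸ H) :=
  (MulAction.toPermHom (Subgroup.normalizer (H : Set G)).op (G ⧸ H)).comp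
    { toFun n := ⟨MulOpposite.op (n : G)⁻¹, Subgroup.inv_mem _ n.2⟩
      map_one' := Subtype.ext (by simp)
      map_mul' m n := Subtype.ext (by simp) }

variable {H}

theorem rightTranslation_mk (n : Subgroup.normalizer (H : Set G)) (g : G) :
    rightTranslation H n (g : G ⧸ H) = ((g * (n : G)⁻¹ : G) : G ⧸ H) :=
  rfl

theorem rightTranslation_eq_one_iff {n : Subgroup.normalizer (H : Set G)} :
    rightTranslation H n = 1 ↔ (n : G) ∈ H := by
  constructor
  · intro h
    have hfix := Equiv.congr_fun h ((1 : G) : G ⧸ H)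
    rw [rightTranslation_mk, Perm.one_apply, QuotientGroup.eq] at hfix
    simpa using hfix
  · refine fun hn => Equiv.ext fun x => ?_
    induction x using QuotientGroup.induction_on with
    | H g =>
      rw [rightTranslation_mk, Perm.one_apply, QuotientGroup.eq]
      simpa using hn

theorem mem_centralizer_range_toPermHom {α : Perm (G ⧸ H)} :
    α ∈ Subgroup.centralizer ((MulAction.toPermHom G (G ⧸ H)).range : Set (Perm (G ⧸ H))) ↔
      ∀ (g : G) x, α (g • x) = g • α x := by
  rw [Subgroup.mem_centralizer_iff]
  constructor
  · exact fun h g x => (Equiv.congr_fun (h _ ⟨g, rfl⟩) x).symm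
  · rintro h _ ⟨g, rfl⟩
    exact Equiv.ext fun x => (h g x).symm

theorem range_rightTranslation : (rightTranslation H).range =
    Subgroup.centralizer ((MulAction.toPermHom G (G ⧸ H)).range : Set (Perm (G ⧸ H))) := by
  ext α
  rw [mem_centralizer_range_toPermHom]
  constructor
  · rintro ⟨n, rfl⟩ g x
    induction x using QuotientGroup.induction_on with
    | H a => exact congrArg QuotientGroup.mk (mul_assoc g a _)
  · intro hα
    obtain ⟨a, ha⟩ := QuotientGroup.mk_surjective (α ((1 : G) : G ⧸ H))
    have hmk (g : G) : α (g : G ⧸ H) = ((g * a : G) : G ⧸ H) := by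
      have h := hα g (1 : G)
      rwa [← ha, MulAction.Quotient.smul_mk, MulAction.Quotient.smul_mk, smul_eq_mul,
        mul_one] at h
    have hnorm : a ∈ Subgroup.normalizer H := by
      refine Subgroup.mem_normalizer_iff''.2 fun h => ?_
      have hfix : α ((1 : G) : G ⧸ H) = α (h : G ⧸ H) ↔ h ∈ H := by
        rw [α.injective.eq_iff, QuotientGroup.eq]
        simp
      rw [← hfix, hmk, hmk, QuotientGroup.eq]
      simp [mul_assoc]
    refine ⟨⟨a, hnorm⟩⁻¹, Equiv.ext fun x => ?_⟩
    induction x using QuotientGroup.induction_on with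
    | H g => rw [rightTranslation_mk, hmk, Subgroup.coe_inv, inv_inv]

end RightTranslation

/-- The homomorphism `j` embeds `K` as a complement of `H` in the normaliser of `H`. -/
structure IsNormalizerComplement {K G : Type*} [Group K] [Group G] (j : K →* G)
    (H : Subgroup G) : Prop where
  mem_normalizer (k : K) : j k ∈ Subgroup.normalizer H
  eq_one_of_mem {k : K} : j k ∈ H → k = 1
  exists_eq_mul {g : G} : g ∈ Subgroup.normalizer H → ∃ k, ∃ h ∈ H, g = j k * h

namespace IsNormalizerComplement

variable {K G K' G' : Type*} [Group K] [Group G] [Group K'] [Group G'] {j : K →* G}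
  {j' : K' →* G'} {H : Subgroup G} {H' : Subgroup G'}

theorem prodMap (h : IsNormalizerComplement j H) (h' : IsNormalizerComplement j' H') :
    IsNormalizerComplement (j.prodMap j') (H.prod H') where
  mem_normalizer k := Subgroup.mem_normalizer_iff.2 fun x =>
    and_congr (Subgroup.mem_normalizer_iff.1 (h.mem_normalizer k.1) x.1)
      (Subgroup.mem_normalizer_iff.1 (h'.mem_normalizer k.2) x.2)
  eq_one_of_mem hk := Prod.ext (h.eq_one_of_mem hk.1) (h'.eq_one_of_mem hk.2)
  exists_eq_mul {g} hg := by
    have hg₁ : g.1 ∈ Subgroup.normalizer H := Subgroup.mem_normalizer_iff.2 fun x => by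
      simpa [Subgroup.mem_prod] using Subgroup.mem_normalizer_iff.1 hg (x, 1)
    have hg₂ : g.2 ∈ Subgroup.normalizer H' := Subgroup.mem_normalizer_iff.2 fun x => by
      simpa [Subgroup.mem_prod] using Subgroup.mem_normalizer_iff.1 hg (1, x)
    obtain ⟨k, a, ha, hga⟩ := h.exists_eq_mul hg₁
    obtain ⟨k', a', ha', hga'⟩ := h'.exists_eq_mul hg₂
    exact ⟨(k, k'), (a, a'), ⟨ha, ha'⟩, Prod.ext hga hga'⟩

theorem id_bot : IsNormalizerComplement (MonoidHom.id G) ⊥ where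
  mem_normalizer g := by
    rw [Subgroup.normalizer_eq_top]
    exact Subgroup.mem_top g
  eq_one_of_mem hg := hg
  exists_eq_mul {g} _ := ⟨g, 1, one_mem _, (mul_one g).symm⟩

theorem map_of_injective (h : IsNormalizerComplement j H) {f : G →* G'}
    (hf : Function.Injective f)
    (hrange : Subgroup.normalizer (H.map f : Set G') ≤ f.range) :
    IsNormalizerComplement (f.comp j) (H.map f) where
  mem_normalizer k := Subgroup.le_normalizer_map f ⟨_, h.mem_normalizer k, rfl⟩
  eq_one_of_mem hk := h.eq_one_of_mem ((Subgroup.mem_map_iff_mem hf).1 hk)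
  exists_eq_mul {g} hg := by
    obtain ⟨p, rfl⟩ := hrange hg
    have hp : p ∈ Subgroup.normalizer H := Subgroup.mem_normalizer_iff.2 fun x => by
      rw [← Subgroup.mem_map_iff_mem hf, Subgroup.mem_normalizer_iff.1 hg (f x), ← map_inv,
        ← map_mul, ← map_mul, Subgroup.mem_map_iff_mem hf]
    obtain ⟨k, a, ha, rfl⟩ := h.exists_eq_mul hp
    exact ⟨k, f a, ⟨a, ha, rfl⟩, map_mul f _ _⟩

theorem nonempty_centralizer_mulEquiv (h : IsNormalizerComplement j H) :
    Nonempty (Subgroup.centralizer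
      ((MulAction.toPermHom G (G ⧸ H)).range : Set (Perm (G ⧸ H))) ≃* K) := by
  let R : K →* Perm (G ⧸ H) := (rightTranslation H).comp (j.codRestrict _ h.mem_normalizer)
  have hinj : Function.Injective R := (injective_iff_map_eq_one R).2 fun k hk =>
    h.eq_one_of_mem (rightTranslation_eq_one_iff.1 hk)
  have hrange : R.range = (rightTranslation H).range := by
    refine le_antisymm ?_ ?_
    · rintro _ ⟨k, rfl⟩
      exact ⟨_, rfl⟩
    · rintro _ ⟨⟨g, hg⟩, rfl⟩
      obtain ⟨k, a, ha, rfl⟩ := h.exists_eq_mul hg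
      have hmem := Subgroup.le_normalizer (H := H) ha
      refine ⟨k, ?_⟩
      have hmul := map_mul (rightTranslation H) ⟨j k, h.mem_normalizer k⟩ ⟨a, hmem⟩
      have hone : rightTranslation H ⟨a, hmem⟩ = 1 := rightTranslation_eq_one_iff.2 ha
      rw [hone, mul_one] at hmul
      exact hmul.symm
  exact ⟨((MonoidHom.ofInjective hinj).trans
    (MulEquiv.subgroupCongr (hrange.trans range_rightTranslation))).symm⟩

end IsNormalizerComplement

namespace Dessin

variable {M : Type*} [Group M] [Finite M] {H : Subgroup M} {m₀ m₁ : M}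
  (hgen : Subgroup.closure {m₀, m₁} = ⊤)

theorem monodromyGroup_ofCosets :
    (ofCosets H m₀ m₁ hgen).monodromyGroup = (MulAction.toPermHom M (M ⧸ H)).range := by
  rw [MonoidHom.range_eq_map, ← hgen, MonoidHom.map_closure, Set.image_pair]
  rfl

theorem automorphismGroup_ofCosets : (ofCosets H m₀ m₁ hgen).automorphismGroup =
    Subgroup.centralizer ((MulAction.toPermHom M (M ⧸ H)).range : Set (Perm (M ⧸ H))) := by
  rw [← monodromyGroup_ofCosets hgen]
  exact (Subgroup.centralizer_closure _).symm

theorem nonempty_automorphismGroup_mulEquiv {K : Type*} [Group K] {j : K →* M}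
    (h : IsNormalizerComplement j H) :
    Nonempty ((ofCosets H m₀ m₁ hgen).automorphismGroup ≃* K) := by
  rw [automorphismGroup_ofCosets]
  exact h.nonempty_centralizer_mulEquiv

/-- The action of `M` on the cosets of a core-free subgroup identifies `M` with the monodromy
group. -/
noncomputable def monodromyEquiv (hcore : H.normalCore = ⊥) :
    M ≃* (ofCosets H m₀ m₁ hgen).monodromyGroup :=
  (MonoidHom.ofInjective (f := MulAction.toPermHom M (M ⧸ H))
    ((MonoidHom.ker_eq_bot_iff _).1 (by rw [← Subgroup.normalCore_eq_ker, hcore]))).trans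
      (MulEquiv.subgroupCongr (monodromyGroup_ofCosets hgen).symm)

theorem nonempty_edgeStabilizer_mulEquiv (hcore : H.normalCore = ⊥) (e : M ⧸ H) :
    Nonempty ((ofCosets H m₀ m₁ hgen).edgeStabilizer e ≃* H) := by
  let φ := monodromyEquiv hgen hcore
  obtain ⟨g, hg⟩ := MulAction.exists_smul_eq M ((1 : M) : M ⧸ H) e
  have hmap : (MulAction.stabilizer M e).map φ.toMonoidHom =
      (ofCosets H m₀ m₁ hgen).edgeStabilizer e := by
    ext x
    rw [Subgroup.mem_map_equiv]
    obtain ⟨m, rfl⟩ := φ.surjective x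
    rw [MulEquiv.symm_apply_apply]
    rfl
  exact ⟨((φ.subgroupMap _).trans (MulEquiv.subgroupCongr hmap)).symm.trans
    ((MulAction.stabilizerEquivStabilizer hg.symm).symm.trans
      (MulEquiv.subgroupCongr (MulAction.stabilizer_quotient H)))⟩

end Dessin

/-! ### Generators of `Sₙ × Sₙ` -/

/-- A pair of odd cycles `x`, `y` generating the symmetric group whose product is inverse to an
even cycle `z` of order prime to those of `x` and `y`, each of them fixing at most one point. -/
structure IsAlmostFullCycleTriple {α : Type*} [DecidableEq α] [Fintype α] (x y z : Perm α) :
    Prop where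
  inv_mul_eq : (x * y)⁻¹ = z
  closure_eq_top : Subgroup.closure {x, y} = ⊤
  isCycle_left : x.IsCycle
  isCycle_right : y.IsCycle
  isCycle_inv : z.IsCycle
  card_le_left : Fintype.card α ≤ x.support.card + 1
  card_le_right : Fintype.card α ≤ y.support.card + 1
  card_le_inv : Fintype.card α ≤ z.support.card + 1
  sign_left : Perm.sign x = -1
  sign_right : Perm.sign y = -1
  coprime_left : (orderOf x).Coprime (orderOf z)
  coprime_right : (orderOf y).Coprime (orderOf z)

theorem isCycle_swap_mul_finRotate (m : ℕ) :
    (swap 0 (finRotate (m + 3) 0) * finRotate (m + 3)).IsCycle ∧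
      (swap 0 (finRotate (m + 3) 0) * finRotate (m + 3)).support.card = m + 2 := by
  have h₁ : finRotate (m + 3) 0 ≠ 0 := by simp
  have h₂ : finRotate (m + 3) (finRotate (m + 3) 0) ≠ 0 := by
    simp [Fin.ext_iff, Fin.val_add, Nat.mod_eq_of_lt (show 2 < m + 3 by omega)]
  refine ⟨isCycle_finRotate.swap_mul h₁ h₂, ?_⟩
  rw [Perm.support_swap_mul_eq _ _ h₂, support_finRotate, Finset.card_sdiff_of_subset (by simp)]
  simp

-- Of the two cycles `finRotate n` and `swap 0 1 * finRotate n` of lengths `n` and `n - 1`, the one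
-- of even length is `c`.
theorem exists_even_cycle_mul_swap_odd_cycle {n : ℕ} (hn : 3 ≤ n) :
    ∃ c s : Perm (Fin n), s * s = 1 ∧ c.IsCycle ∧ (s * c).IsCycle ∧ Even c.support.card ∧
      Odd (s * c).support.card ∧ n ≤ c.support.card + 1 ∧ n ≤ (s * c).support.card + 1 ∧
      c.support.card.Coprime (s * c).support.card ∧ Subgroup.closure {c, s} = ⊤ := by
  obtain ⟨m, rfl⟩ := Nat.exists_eq_add_of_le' hn
  obtain ⟨hcycle, hcard⟩ := isCycle_swap_mul_finRotate m
  set f := finRotate (m + 3)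
  set s := swap 0 (f 0)
  have hs : s * s = 1 := swap_mul_self _ _
  have hf : f.support.card = m + 3 := by rw [support_finRotate, Finset.card_fin]
  have hclosure : Subgroup.closure {f, s} = ⊤ :=
    Perm.closure_cycle_adjacent_swap isCycle_finRotate support_finRotate 0
  rcases Nat.even_or_odd m with hm | hm
  · have hsf : s * (s * f) = f := by rw [← mul_assoc, hs, one_mul]
    refine ⟨s * f, s, hs, hcycle, ?_⟩
    rw [hsf, hcard, hf]
    refine ⟨isCycle_finRotate, hm.add even_two, hm.add_odd (by decide), le_rfl, Nat.le_succ _,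
      Nat.coprime_self_add_right.2 (Nat.coprime_one_right _), ?_⟩
    rw [eq_top_iff, ← hclosure, Subgroup.closure_le]
    have hmem : s ∈ Subgroup.closure {s * f, s} := Subgroup.subset_closure (by simp)
    rintro x (rfl | rfl)
    · have hmul := mul_mem hmem (Subgroup.subset_closure (Set.mem_insert (s * f) {s}))
      rwa [hsf] at hmul
    · exact hmem
  · refine ⟨f, s, hs, isCycle_finRotate, hcycle, ?_⟩
    rw [hcard, hf]
    exact ⟨hm.add_odd (by decide), hm.add_even even_two, Nat.le_succ _, le_rfl,
      Nat.coprime_self_add_left.2 (Nat.coprime_one_left _), hclosure⟩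

-- With `c`, `s` and `d = s c` as above, the triple is `s c s`, `c` and `d⁻²`.
theorem exists_isAlmostFullCycleTriple {n : ℕ} (hn : 3 ≤ n) :
    ∃ x y z : Perm (Fin n), IsAlmostFullCycleTriple x y z := by
  obtain ⟨c, s, hs, hc, hd, hc_even, hd_odd, hc_card, hd_card, hcop, hclosure⟩ :=
    exists_even_cycle_mul_swap_odd_cycle hn
  set d := s * c with hdc
  have hconj : s * c * s = s * c * s⁻¹ := by rw [inv_eq_of_mul_eq_one_left hs]
  have hx : (s * c * s).IsCycle := hconj ▸ hc.conj
  have hx_card : (s * c * s).support.card = c.support.card := by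
    rw [hconj, Perm.card_support_conj]
  have hxy : s * c * s * c = d ^ 2 := by rw [hdc, pow_two, mul_assoc]
  have hd_order : Odd (orderOf d) := hd.orderOf ▸ hd_odd
  have hz_order : orderOf (d ^ 2)⁻¹ = orderOf d := by
    rw [orderOf_inv, Nat.Coprime.orderOf_pow (Nat.coprime_two_right.2 hd_order)]
  have hz : (d ^ 2).IsCycle := hd.pow_iff.2 (Nat.coprime_two_left.2 hd_order)
  refine ⟨s * c * s, c, (d ^ 2)⁻¹, by rw [hxy], ?_, hx, hc, hz.inv, ?_, ?_, ?_, ?_, ?_, ?_, ?_⟩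
  · have hscs : s * c * s ∈ Subgroup.closure {s * c * s, c} :=
      Subgroup.subset_closure (by simp)
    have hc_mem : c ∈ Subgroup.closure {s * c * s, c} := Subgroup.subset_closure (by simp)
    have hd_mem : d ∈ Subgroup.closure {s * c * s, c} := by
      obtain ⟨k, hk⟩ := exists_pow_eq_self_of_coprime (Nat.coprime_two_left.2 hd_order)
      exact hk ▸ pow_mem (hxy ▸ mul_mem hscs hc_mem) k
    rw [eq_top_iff, ← hclosure, Subgroup.closure_le]
    rintro x (rfl | rfl)
    · exact hc_mem
    · simpa [hdc] using mul_mem hd_mem (inv_mem hc_mem)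
  · rw [Fintype.card_fin, hx_card]; exact hc_card
  · rw [Fintype.card_fin]; exact hc_card
  · rw [Fintype.card_fin, ← hz.inv.orderOf, hz_order, hd.orderOf]; exact hd_card
  · rw [hx.sign, hx_card, hc_even.neg_one_pow]
  · rw [hc.sign, hc_even.neg_one_pow]
  · rw [hz_order, hx.orderOf, hd.orderOf, hx_card]; exact hcop
  · rw [hz_order, hc.orderOf, hd.orderOf]; exact hcop

theorem mk_one_mem_of_coprime {G G' : Type*} [Group G] [Group G'] {T : Subgroup (G × G')}
    {a : G} {b : G'} (h : (a, b) ∈ T) (hab : (orderOf a).Coprime (orderOf b)) :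
    (a, 1) ∈ T ∧ (1, b) ∈ T := by
  obtain ⟨k, hka, hkb⟩ := Nat.chineseRemainder hab 1 0
  have hpow : (a, b) ^ k = (a, 1) :=
    Prod.ext ((pow_eq_pow_iff_modEq.2 hka).trans (pow_one a))
      ((pow_eq_pow_iff_modEq.2 hkb).trans (pow_zero b))
  have ha : (a, (1 : G')) ∈ T := hpow ▸ pow_mem h k
  exact ⟨ha, by simpa using mul_mem (inv_mem ha) h⟩

theorem closure_pair_prod_eq_top {G : Type*} [Group G] {x y z : G} (hz : (x * y)⁻¹ = z)
    (hxy : Subgroup.closure {x, y} = ⊤) (hxz : (orderOf x).Coprime (orderOf z))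
    (hyz : (orderOf y).Coprime (orderOf z)) :
    Subgroup.closure {((x, z) : G × G), (y, x)} = ⊤ := by
  have hyz_top : Subgroup.closure {y, z} = ⊤ := by rw [← hz, closure_pair_twist, hxy]
  have hzx_top : Subgroup.closure {z, x} = ⊤ := by
    have hx_eq : (y * z)⁻¹ = x := by simp [← hz]
    rw [← hyz_top, ← closure_pair_twist y z, hx_eq]
  set T := Subgroup.closure {((x, z) : G × G), (y, x)}
  have h₀ : (x, z) ∈ T := Subgroup.subset_closure (by simp)
  have h₁ : (y, x) ∈ T := Subgroup.subset_closure (by simp)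
  have hinf : (z, y) ∈ T := by
    convert inv_mem (mul_mem h₀ h₁) using 1
    simp [← hz]
  obtain ⟨hx_inl, hz_inr⟩ := mk_one_mem_of_coprime h₀ hxz
  obtain ⟨hz_inl, hy_inr⟩ := mk_one_mem_of_coprime hinf hyz.symm
  rw [eq_top_iff, ← Subgroup.top_prod_top, Subgroup.prod_le_iff, Subgroup.map_le_iff_le_comap,
    Subgroup.map_le_iff_le_comap]
  constructor
  · rw [← hzx_top, Subgroup.closure_le]
    rintro g (rfl | rfl)
    exacts [hz_inl, hx_inl]
  · rw [← hyz_top, Subgroup.closure_le]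
    rintro g (rfl | rfl)
    exacts [hy_inr, hz_inr]

namespace IsAlmostFullCycleTriple

variable {α : Type*} [DecidableEq α] [Fintype α] {x y z : Perm α}

theorem sign_inv (h : IsAlmostFullCycleTriple x y z) : Perm.sign z = 1 := by
  rw [← h.inv_mul_eq, map_inv, map_mul, h.sign_left, h.sign_right, neg_mul_neg, mul_one, inv_one]

theorem closure_prod_eq_top (h : IsAlmostFullCycleTriple x y z) :
    Subgroup.closure {(x, z), (y, x)} = ⊤ :=
  closure_pair_prod_eq_top h.inv_mul_eq h.closure_eq_top h.coprime_left h.coprime_right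

theorem inv_mul_prod_eq (h : IsAlmostFullCycleTriple x y z) :
    ((x, z) * (y, x) : Perm α × Perm α)⁻¹ = (z, y) := by
  simp [← h.inv_mul_eq]

section Semiregular

variable {A B : Subgroup (Perm α)}

theorem isSemiregular (h : IsAlmostFullCycleTriple x y z)
    (hA : ∀ τ ∈ A, τ.support.card + 1 < Fintype.card α) :
    IsSemiregular (Perm α ⧸ A) x ∧ IsSemiregular (Perm α ⧸ A) y ∧
      IsSemiregular (Perm α ⧸ A) z :=
  ⟨.of_isCycle h.isCycle_left fun τ hτ => by have := hA τ hτ; have := h.card_le_left; omega,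
    .of_isCycle h.isCycle_right fun τ hτ => by have := hA τ hτ; have := h.card_le_right; omega,
    .of_isCycle h.isCycle_inv fun τ hτ => by have := hA τ hτ; have := h.card_le_inv; omega⟩

theorem passport_eq (h : IsAlmostFullCycleTriple x y z)
    (hA : ∀ τ ∈ A, τ.support.card + 1 < Fintype.card α)
    (hB : ∀ τ ∈ B, τ.support.card + 1 < Fintype.card α) :
    (Dessin.ofCosets (A.prod B) (x, z) (y, x) h.closure_prod_eq_top).passport =
      (Multiset.replicate ((A.prod B).index / orderOf (x, z)) (orderOf (x, z)),
        Multiset.replicate ((A.prod B).index / orderOf (y, x)) (orderOf (y, x)),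
        Multiset.replicate ((A.prod B).index / orderOf (z, y)) (orderOf (z, y))) := by
  obtain ⟨hxA, hyA, hzA⟩ := h.isSemiregular hA
  obtain ⟨hxB, hyB, hzB⟩ := h.isSemiregular hB
  rw [Dessin.passport_ofCosets _ _ (hxA.quotient_prod hzB) (hyA.quotient_prod hxB)
    (h.inv_mul_prod_eq ▸ hzA.quotient_prod hyB), h.inv_mul_prod_eq]

end Semiregular

end IsAlmostFullCycleTriple

/-! ### Signed permutations -/

/-- The group of signed permutations of `α`: the hyperoctahedral group, with an element `w` acting
on sign vectors as the permutation `w.right` followed by the sign changes `w.left`. -/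
abbrev SignedPerm (α : Type*) : Type _ := (α → ℤˣ) ⋊[mulAutArrow] Perm α

namespace SignedPerm

section Action

variable {α : Type*}

theorem mul_left_apply (v w : SignedPerm α) (k : α) :
    (v * w).left k = v.left k * w.left (v.right⁻¹ k) := rfl

/-- The action of the signed permutations on the signed points `(k, s) = s e_k`; for the three
coordinate axes these are the faces of the cube. -/
def toPerm : SignedPerm α →* Perm (α × ℤˣ) where
  toFun w :=
    { toFun := fun f => (w.right f.1, w.left (w.right f.1) * f.2)
      invFun := fun f => (w.right⁻¹ f.1, w.left f.1 * f.2)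
      left_inv := fun f => by ext <;> simp [← mul_assoc]
      right_inv := fun f => by ext <;> simp [← mul_assoc] }
  map_one' := by ext f <;> simp
  map_mul' v w := Equiv.ext fun f => Prod.ext rfl <| by
    simp [mul_left_apply, mul_assoc, -SemidirectProduct.mul_left]

theorem toPerm_apply (w : SignedPerm α) (f : α × ℤˣ) :
    toPerm w f = (w.right f.1, w.left (w.right f.1) * f.2) := rfl

theorem toPerm_injective : Function.Injective (toPerm (α := α)) := by
  rw [injective_iff_map_eq_one]
  intro w hw
  have hfix (k : α) : (w.right k, w.left (w.right k) * 1) = (k, 1) := Equiv.congr_fun hw (k, 1)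
  have hright : w.right = 1 := Equiv.ext fun k => congrArg Prod.fst (hfix k)
  exact SemidirectProduct.ext
    (funext fun k => by simpa [hright] using congrArg Prod.snd (hfix k)) hright

/-- The change of all the signs by `s`: the identity or the antipodal map. -/
def scalar : ℤˣ →* SignedPerm α := SemidirectProduct.inl.comp (Pi.constMonoidHom α ℤˣ)

theorem commute_scalar (s : ℤˣ) (w : SignedPerm α) : Commute (scalar s) w :=
  SemidirectProduct.ext (funext fun k => mul_comm s (w.left k))
    ((one_mul w.right).trans (mul_one w.right).symm)

theorem scalar_mul_scalar_mul (s : ℤˣ) (w : SignedPerm α) : scalar s * (scalar s * w) = w := by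
  rw [← mul_assoc, ← map_mul, ← sq, Int.units_sq, map_one, one_mul]

theorem toPerm_scalar (s : ℤˣ) (f : α × ℤˣ) : toPerm (scalar s) f = (f.1, s * f.2) := rfl

theorem mem_range_toPerm [Finite α] {π : Perm (α × ℤˣ)}
    (h : ∀ f, π (toPerm (scalar (-1)) f) = toPerm (scalar (-1)) (π f)) : π ∈ toPerm.range := by
  have hπ (k : α) (s : ℤˣ) : π (k, s) = ((π (k, 1)).1, (π (k, 1)).2 * s) := by
    rcases Int.units_eq_one_or s with rfl | rfl
    · rw [mul_one]
    · simpa [toPerm_scalar, mul_comm] using h (k, 1)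
  have hinj : Function.Injective fun k => (π (k, 1)).1 := fun k l hkl => by
    have : π (k, (π (k, 1)).2) = π (l, (π (l, 1)).2) := by
      rw [hπ k, hπ l, ← sq, ← sq, Int.units_sq, Int.units_sq]
      exact Prod.ext hkl rfl
    exact congrArg Prod.fst (π.injective this)
  let ρ : Perm α := Equiv.ofBijective _ (Finite.injective_iff_bijective.1 hinj)
  refine ⟨⟨fun k => (π (ρ⁻¹ k, 1)).2, ρ⟩, Equiv.ext fun f => ?_⟩
  have hρ : ρ⁻¹ (ρ f.1) = f.1 := ρ.symm_apply_apply f.1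
  rw [toPerm_apply, hπ f.1 f.2]
  refine Prod.ext rfl ?_
  change (π (ρ⁻¹ (ρ f.1), 1)).2 * f.2 = _
  rw [hρ]

/-- The signed permutation `diag(-1, …, 1, …, -1)` fixing the points `(k, ±1)` only; for the three
coordinate axes, the half turn about the `k`-th axis. -/
def halfTurn [DecidableEq α] (k : α) : SignedPerm α :=
  SemidirectProduct.inl fun i => if i = k then 1 else -1

theorem toPerm_halfTurn_eq_self_iff [DecidableEq α] {k : α} {f : α × ℤˣ} :
    toPerm (halfTurn k) f = f ↔ f.1 = k := by
  change (f.1, (if f.1 = k then 1 else -1) * f.2) = f ↔ f.1 = k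
  by_cases hk : f.1 = k
  · simp [hk, Prod.ext_iff]
  · simp [hk, Prod.ext_iff]

end Action

section Characters

variable {α : Type*}

/-- The isomorphism between two kernels which are both complements of the central subgroup of order
two: it sends `w` to `w` or to its product with the antipodal map. -/
def kerEquivKer {χ χ' : SignedPerm α →* ℤˣ} (h : ∀ s, χ (scalar s) = s)
    (h' : ∀ s, χ' (scalar s) = s) : χ.ker ≃* χ'.ker where
  toFun w := ⟨scalar (χ' w) * (w : SignedPerm α), by
    rw [MonoidHom.mem_ker, map_mul, h', ← sq, Int.units_sq]⟩
  invFun w := ⟨scalar (χ w) * (w : SignedPerm α), by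
    rw [MonoidHom.mem_ker, map_mul, h, ← sq, Int.units_sq]⟩
  left_inv := fun ⟨w, hw⟩ => Subtype.ext <| by
    change scalar (χ (scalar (χ' w) * w)) * (scalar (χ' w) * w) = w
    rw [map_mul, h, MonoidHom.mem_ker.1 hw, mul_one, scalar_mul_scalar_mul]
  right_inv := fun ⟨w, hw⟩ => Subtype.ext <| by
    change scalar (χ' (scalar (χ w) * w)) * (scalar (χ w) * w) = w
    rw [map_mul, h', MonoidHom.mem_ker.1 hw, mul_one, scalar_mul_scalar_mul]
  map_mul' := fun ⟨v, _⟩ ⟨w, _⟩ => Subtype.ext <| by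
    change scalar (χ' (v * w)) * (v * w) = scalar (χ' v) * v * (scalar (χ' w) * w)
    rw [map_mul, map_mul]
    exact (commute_scalar (χ' w) v).mul_mul_mul_comm _ _

theorem mem_range_toPerm_of_mem_normalizer [Finite α] [DecidableEq α] {χ : SignedPerm α →* ℤˣ}
    (hhalf : ∀ k, χ (halfTurn k) = 1) {π : Perm (α × ℤˣ)}
    (hπ : π ∈ Subgroup.normalizer (χ.ker.map toPerm : Set (Perm (α × ℤˣ)))) :
    π ∈ toPerm.range := by
  -- The conjugate by `π` of the half turn about the axis of `f` fixes exactly `π f` and the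
  -- image of the antipode of `f`; being a signed permutation it also fixes the antipode of `π f`.
  refine mem_range_toPerm fun f => ?_
  obtain ⟨v, -, hv⟩ := (Subgroup.mem_normalizer_iff.1 hπ _).1 ⟨halfTurn f.1, hhalf f.1, rfl⟩
  have hconj (x : α × ℤˣ) : toPerm v (π x) = π x ↔ x.1 = f.1 := by
    rw [← toPerm_halfTurn_eq_self_iff, hv]
    simp only [Perm.mul_apply, Perm.inv_def, symm_apply_apply, π.injective.eq_iff]
  have hfix : toPerm v (toPerm (scalar (-1)) (π f)) = toPerm (scalar (-1)) (π f) := by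
    rw [← Perm.mul_apply, ← map_mul, ← (commute_scalar _ _).eq, map_mul, Perm.mul_apply,
      (hconj f).2 rfl]
  obtain ⟨x, hx⟩ := π.surjective (toPerm (scalar (-1)) (π f))
  rw [← hx, hconj] at hfix
  have hne : x ≠ f := by
    rintro rfl
    exact absurd (congrArg Prod.snd hx) (by simp [toPerm_scalar])
  have hsnd : x.2 = -1 * f.2 := by
    rw [neg_one_mul]
    exact Int.units_ne_iff_eq_neg.1 fun h => hne (Prod.ext hfix h)
  rw [← hx, toPerm_scalar, ← hsnd, ← hfix]

theorem isNormalizerComplement_map_ker [Finite α] [DecidableEq α] {χ : SignedPerm α →* ℤˣ}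
    (hscalar : ∀ s, χ (scalar s) = s) (hhalf : ∀ k, χ (halfTurn k) = 1) :
    IsNormalizerComplement (toPerm.comp scalar) (χ.ker.map toPerm) where
  mem_normalizer s := by
    refine Subgroup.centralizer_le_normalizer _ (Subgroup.mem_centralizer_iff.2 ?_)
    rintro _ ⟨w, -, rfl⟩
    exact ((commute_scalar s w).map toPerm).eq.symm
  eq_one_of_mem := by
    rintro s ⟨w, hw, hws⟩
    rw [← hscalar s, ← toPerm_injective hws]
    exact hw
  exists_eq_mul {π} hπ := by
    obtain ⟨w, rfl⟩ := mem_range_toPerm_of_mem_normalizer hhalf hπ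
    exact ⟨χ w, toPerm (scalar (χ w) * w),
      ⟨_, by rw [SetLike.mem_coe, MonoidHom.mem_ker, map_mul, hscalar, ← sq, Int.units_sq], rfl⟩,
      by rw [MonoidHom.comp_apply, ← map_mul, scalar_mul_scalar_mul]⟩

end Characters

section Matrices

variable {α : Type*} [Fintype α]

/-- The product of the signs of a signed permutation. -/
def signProd : SignedPerm α →* ℤˣ where
  toFun w := ∏ k, w.left k
  map_one' := by simp
  map_mul' v w := by
    simp_rw [mul_left_apply]
    rw [Finset.prod_mul_distrib, Equiv.prod_comp v.right⁻¹ w.left]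

theorem signProd_apply (w : SignedPerm α) : signProd w = ∏ k, w.left k := rfl

variable [DecidableEq α]

theorem sign_toPerm (w : SignedPerm α) : Perm.sign (toPerm w) = signProd w := by
  have hmulLeft : ∀ s : ℤˣ, Perm.sign (Equiv.mulLeft s) = s := by decide
  have hfactor : toPerm w = prodCongrRight (fun k => Equiv.mulLeft (w.left k)) *
      prodCongrLeft fun _ => w.right :=
    Equiv.ext fun _ => rfl
  rw [hfactor, map_mul, Perm.sign_prodCongrRight, Perm.sign_prodCongrLeft, signProd_apply]
  simp [hmulLeft]

/-- The determinant of the matrix of a signed permutation. -/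
def det : SignedPerm α →* ℤˣ := Perm.sign.comp SemidirectProduct.rightHom * signProd

theorem det_apply (w : SignedPerm α) : det w = Perm.sign w.right * signProd w := rfl

/-- The monomial matrix of a signed permutation.  The inverse appears because `Perm.permMatrix` is
an antihomomorphism. -/
def toMatrix (w : SignedPerm α) : Matrix α α ℤ :=
  Matrix.diagonal (fun k => (w.left k : ℤ)) * Perm.permMatrix ℤ w.right⁻¹

theorem toMatrix_mulVec_apply (w : SignedPerm α) (v : α → ℤ) (i : α) :
    w.toMatrix.mulVec v i = w.left i * v (w.right⁻¹ i) := by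
  rw [toMatrix, ← Matrix.mulVec_mulVec, Matrix.mulVec_diagonal, Matrix.permMatrix_mulVec]
  rfl

theorem toMatrix_mul_transpose (w : SignedPerm α) : w.toMatrix * w.toMatrix.transpose = 1 := by
  have hsq (k : α) : (w.left k : ℤ) * w.left k = 1 := by
    rw [← Units.val_mul, ← sq, Int.units_sq, Units.val_one]
  rw [toMatrix, Matrix.transpose_mul, Matrix.transpose_permMatrix, Matrix.diagonal_transpose,
    Matrix.mul_assoc, ← Matrix.mul_assoc (Perm.permMatrix ℤ _), ← Matrix.permMatrix_mul,
    inv_mul_cancel, Matrix.permMatrix_one, Matrix.one_mul, Matrix.diagonal_mul_diagonal]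
  simp only [hsq, Matrix.diagonal_one]

/-- The matrix of a signed permutation, as an orthogonal matrix. -/
def toOrthogonal (w : SignedPerm α) : Matrix.orthogonalGroup α ℤ :=
  ⟨w.toMatrix, (Matrix.mem_orthogonalGroup_iff _ _).2 w.toMatrix_mul_transpose⟩

theorem det_toMatrix (w : SignedPerm α) : w.toMatrix.det = (det w : ℤ) := by
  rw [toMatrix, Matrix.det_mul, Matrix.det_diagonal, Matrix.det_permutation, det_apply,
    signProd_apply, Perm.sign_inv, mul_comm, Units.val_mul, Units.coe_prod]
  rfl

end Matrices

end SignedPerm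

/-! ### The two groups of the cube -/

namespace CubeFace

theorem normal_injective : Function.Injective normal := by
  decide

theorem normal_antipode (f : CubeFace) :
    normal (SignedPerm.toPerm (SignedPerm.scalar (-1)) f) = -f.normal := by
  simp [SignedPerm.toPerm_scalar, normal, Pi.single_neg]

theorem toMatrix_mulVec_normal (w : SignedPerm (Fin 3)) (f : CubeFace) :
    w.toMatrix.mulVec f.normal = normal (w.toPerm f) := by
  funext i
  rw [SignedPerm.toMatrix_mulVec_apply, SignedPerm.toPerm_apply, normal, normal]
  by_cases h : i = w.right f.1
  · subst h
    simp
  · have h' : w.right⁻¹ i ≠ f.1 := fun h' => h (Perm.inv_eq_iff_eq.1 h')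
    rw [Pi.single_eq_of_ne h', Pi.single_eq_of_ne h, mul_zero]

theorem Induces.exists_signedPerm {g : Matrix.orthogonalGroup (Fin 3) ℤ} {π : Perm CubeFace}
    (h : Induces g π) : ∃ w : SignedPerm (Fin 3), π = w.toPerm ∧ g.1 = w.toMatrix := by
  obtain ⟨w, rfl⟩ : π ∈ SignedPerm.toPerm.range :=
    SignedPerm.mem_range_toPerm fun f => normal_injective <| by
      rw [← h, normal_antipode, Matrix.mulVec_neg, h, normal_antipode]
  refine ⟨w, rfl, Matrix.ext_of_mulVec_single fun k => ?_⟩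
  simpa [normal] using (h (k, 1)).trans (toMatrix_mulVec_normal w (k, 1)).symm

end CubeFace

namespace SignedPerm

theorem toMatrix_mulVec_mem_inscribedTetrahedron_iff {w : SignedPerm (Fin 3)}
    (hw : signProd w = 1) {v : Fin 3 → ℤ} :
    w.toMatrix.mulVec v ∈ inscribedTetrahedron ↔ v ∈ inscribedTetrahedron := by
  simp only [inscribedTetrahedron, Set.mem_ofPred_eq, toMatrix_mulVec_apply]
  refine and_congr (w.right⁻¹.forall_congr fun k => ?_) ?_
  · rcases Int.units_eq_one_or (w.left k) with h | h <;>
      simp only [h, Units.val_one, Units.val_neg] <;> omega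
  · rw [Finset.prod_mul_distrib, Equiv.prod_comp w.right⁻¹ v, ← Units.coe_prod,
      ← signProd_apply, hw, Units.val_one, one_mul]

end SignedPerm

open SignedPerm

theorem cubeRotations_eq_map_ker_det : cubeRotations = det.ker.map toPerm := by
  ext π
  constructor
  · rintro ⟨g, hg, hdet⟩
    obtain ⟨w, rfl, hw⟩ := hg.exists_signedPerm
    rw [hw, det_toMatrix] at hdet
    exact ⟨w, Units.ext hdet, rfl⟩
  · rintro ⟨w, hw, rfl⟩
    exact ⟨w.toOrthogonal, CubeFace.toMatrix_mulVec_normal w,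
      w.det_toMatrix.trans (congrArg Units.val hw)⟩

theorem cubeTetrahedral_eq_map_ker_signProd : cubeTetrahedral = signProd.ker.map toPerm := by
  ext π
  constructor
  · rintro ⟨g, hg, htet⟩
    obtain ⟨w, rfl, hw⟩ := hg.exists_signedPerm
    have hprod : ∏ k, g.1.mulVec (fun _ => 1) k = 1 := ((htet fun _ => 1).2 ⟨by simp, by simp⟩).2
    simp_rw [hw, toMatrix_mulVec_apply, mul_one] at hprod
    exact ⟨w, Units.ext ((Units.coe_prod _ _).trans hprod), rfl⟩
  · rintro ⟨w, hw, rfl⟩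
    exact ⟨w.toOrthogonal, CubeFace.toMatrix_mulVec_normal w,
      fun _ => toMatrix_mulVec_mem_inscribedTetrahedron_iff hw⟩

namespace SignedPerm

/-- The vertices of the inscribed tetrahedron, as vectors of signs. -/
abbrev TetrahedronVertex : Type := {v : Fin 3 → ℤˣ // ∏ k, v k = 1}

instance : MulAction (signProd (α := Fin 3)).ker TetrahedronVertex where
  smul w v := ⟨fun k => w.1.left k * v.1 (w.1.right⁻¹ k), by
    rw [Finset.prod_mul_distrib, ← signProd_apply, MonoidHom.mem_ker.1 w.2,
      Equiv.prod_comp w.1.right⁻¹ v.1, v.2, mul_one]⟩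
  one_smul v := Subtype.ext (funext fun k => one_mul (v.1 k))
  mul_smul w w' v := Subtype.ext (funext fun k => mul_assoc _ _ _)

theorem smul_tetrahedronVertex_apply (w : (signProd (α := Fin 3)).ker) (v : TetrahedronVertex)
    (k : Fin 3) : (w • v).1 k = w.1.left k * v.1 (w.1.right⁻¹ k) := rfl

instance : FaithfulSMul (signProd (α := Fin 3)).ker TetrahedronVertex := by
  refine ⟨fun {w w'} h => ?_⟩
  have hseparate : ∀ ρ ρ' : Perm (Fin 3),
      (∀ (v : TetrahedronVertex) k, v.1 (ρ k) = v.1 (ρ' k)) → ρ = ρ' := by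
    decide
  have hcoord (v : TetrahedronVertex) (k : Fin 3) :
      w.1.left k * v.1 (w.1.right⁻¹ k) = w'.1.left k * v.1 (w'.1.right⁻¹ k) := by
    rw [← smul_tetrahedronVertex_apply, h, smul_tetrahedronVertex_apply]
  have hleft (k : Fin 3) : w.1.left k = w'.1.left k := by
    simpa using hcoord ⟨1, by simp⟩ k
  refine Subtype.ext (SemidirectProduct.ext (funext hleft) (inv_injective ?_))
  exact hseparate _ _ fun v k => mul_left_cancel ((hcoord v k).trans (by rw [hleft]))

theorem nonempty_ker_signProd_mulEquiv :
    Nonempty ((signProd (α := Fin 3)).ker ≃* Perm (Fin 4)) := by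
  let e : (signProd (α := Fin 3)).ker ≃ TetrahedronVertex × Perm (Fin 3) :=
    { toFun := fun w => (⟨w.1.left, w.2⟩, w.1.right)
      invFun := fun p => ⟨⟨p.1.1, p.2⟩, p.1.2⟩
      left_inv := fun _ => rfl
      right_inv := fun _ => rfl }
  have hvertices : Fintype.card TetrahedronVertex = Fintype.card (Fin 4) := by decide
  have hcard : Nat.card (signProd (α := Fin 3)).ker = Nat.card (Perm TetrahedronVertex) := by
    rw [Nat.card_congr e, Nat.card_prod, Nat.card_perm, Nat.card_perm,
      Nat.card_eq_fintype_card, hvertices, Nat.card_fin, Fintype.card_fin]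
    rfl
  have : Finite (signProd (α := Fin 3)).ker := Finite.of_equiv _ e.symm
  exact ⟨(MulEquiv.ofBijective (MulAction.toPermHom _ TetrahedronVertex)
    ((Nat.bijective_iff_injective_and_card _).2 ⟨MulAction.toPerm_injective, hcard⟩)).trans
      (permCongrHom (Fintype.equivOfCardEq hvertices))⟩

end SignedPerm

/-- A common description of the two groups of the cube: the isometries in the kernel of a
character which takes the value `-1` at the antipodal map and `1` at the half turns. -/
def IsCubeGroup (T : Subgroup (Perm CubeFace)) : Prop :=
  ∃ χ : SignedPerm (Fin 3) →* ℤˣ,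
    (∀ s, χ (scalar s) = s) ∧ (∀ k, χ (halfTurn k) = 1) ∧ T = χ.ker.map toPerm

theorem signProd_scalar (s : ℤˣ) : signProd (scalar s : SignedPerm (Fin 3)) = s := by
  revert s
  decide

theorem isCubeGroup_cubeRotations : IsCubeGroup cubeRotations :=
  ⟨det, by decide, by decide, cubeRotations_eq_map_ker_det⟩

theorem isCubeGroup_cubeTetrahedral : IsCubeGroup cubeTetrahedral :=
  ⟨signProd, signProd_scalar, by decide, cubeTetrahedral_eq_map_ker_signProd⟩

namespace IsCubeGroup

variable {T : Subgroup (Perm CubeFace)}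

theorem nonempty_mulEquiv (hT : IsCubeGroup T) : Nonempty (T ≃* Perm (Fin 4)) := by
  obtain ⟨χ, hscalar, -, rfl⟩ := hT
  obtain ⟨e⟩ := nonempty_ker_signProd_mulEquiv
  exact ⟨(Subgroup.equivMapOfInjective _ _ toPerm_injective).symm.trans
    ((kerEquivKer hscalar signProd_scalar).trans e)⟩

theorem isNormalizerComplement (hT : IsCubeGroup T) :
    IsNormalizerComplement (toPerm.comp scalar) T := by
  obtain ⟨χ, hscalar, hhalf, rfl⟩ := hT
  exact isNormalizerComplement_map_ker hscalar hhalf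

theorem exists_apply_ne (hT : IsCubeGroup T) (f : CubeFace) : ∃ t ∈ T, t f ≠ f := by
  obtain ⟨χ, -, hhalf, rfl⟩ := hT
  exact ⟨_, ⟨halfTurn (f.1 + 1), hhalf _, rfl⟩, fun h =>
    absurd (toPerm_halfTurn_eq_self_iff.1 h) (by simp)⟩

end IsCubeGroup

theorem cubeTetrahedral_le_ker_sign : cubeTetrahedral ≤ Perm.sign.ker := by
  rw [cubeTetrahedral_eq_map_ker_signProd]
  rintro _ ⟨w, hw, rfl⟩
  exact (sign_toPerm w).trans hw

theorem not_cubeRotations_le_ker_sign : ¬ cubeRotations ≤ Perm.sign.ker := by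
  rw [cubeRotations_eq_map_ker_det]
  intro hle
  have hdet : det (⟨fun _ => -1, swap 0 1⟩ : SignedPerm (Fin 3)) = 1 := by decide
  have hsign := hle ⟨_, hdet, rfl⟩
  rw [MonoidHom.mem_ker, sign_toPerm] at hsign
  exact absurd hsign (by decide)

theorem map_conj_le_iff_of_normal {G : Type*} [Group G] {H N : Subgroup G} [N.Normal] (g : G) :
    H.map (MulAut.conj g).toMonoidHom ≤ N ↔ H ≤ N := by
  have hN : N.map (MulAut.conj g).toMonoidHom = N := Subgroup.Normal.map_conj_eq N g
  conv_lhs => rw [← hN]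
  exact Subgroup.map_le_map_iff_of_injective (MulAut.conj g).injective

/-! ### Permutation groups on a subset -/

theorem normalCore_prod {G G' : Type*} [Group G] [Group G'] (H : Subgroup G) (H' : Subgroup G') :
    (H.prod H').normalCore = H.normalCore.prod H'.normalCore := by
  ext g
  exact ⟨fun h => ⟨fun x => (h (x, 1)).1, fun x => (h (1, x)).2⟩, fun h x => ⟨h.1 x.1, h.2 x.2⟩⟩

theorem normalCore_eq_bot_of_forall_apply_eq {α : Type*} {A : Subgroup (Perm α)} {y : α}
    (hA : ∀ g ∈ A, g y = y) : A.normalCore = ⊥ := by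
  classical
  refine (Subgroup.eq_bot_iff_forall _).2 fun g hg => Equiv.ext fun x => ?_
  have hconj := hA _ (hg (swap x y))
  rw [swap_inv, Perm.mul_apply, Perm.mul_apply, swap_apply_right, swap_apply_eq_iff,
    swap_apply_right] at hconj
  exact hconj

/-- The permutations of `α` preserving each of the two parts `γ` and `β`. -/
def sumPermHom {α β γ : Type*} (e : γ ⊕ β ≃ α) : Perm γ × Perm β →* Perm α :=
  (permCongrHom e).toMonoidHom.comp (Perm.sumCongrHom γ β)

section ViaEmbedding

variable {α β γ : Type*} {e : γ ⊕ β ≃ α} {ι : γ ↪ α}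

theorem exists_sumEquiv [Fintype α] [Fintype β] [Fintype γ] (ι : γ ↪ α)
    (hcard : Fintype.card γ + Fintype.card β = Fintype.card α) :
    ∃ e : γ ⊕ β ≃ α, ∀ a, e (Sum.inl a) = ι a := by
  classical
  have hcompl : Fintype.card ((Set.range ι)ᶜ : Set α) = Fintype.card β := by
    rw [Fintype.card_compl_set, Set.card_range_of_injective ι.injective]
    omega
  exact ⟨(sumCongr (ofInjective ι ι.injective) (Fintype.equivOfCardEq hcompl).symm).trans
    (Set.sumCompl (Set.range ι)), fun _ => rfl⟩

theorem sumPermHom_apply_inl (p : Perm γ × Perm β) (a : γ) :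
    sumPermHom e p (e (Sum.inl a)) = e (Sum.inl (p.1 a)) := by
  simp [sumPermHom, permCongrHom]

theorem sumPermHom_apply_inr (p : Perm γ × Perm β) (b : β) :
    sumPermHom e p (e (Sum.inr b)) = e (Sum.inr (p.2 b)) := by
  simp [sumPermHom, permCongrHom]

theorem sumPermHom_injective : Function.Injective (sumPermHom e) :=
  (permCongrHom e).injective.comp Perm.sumCongrHom_injective

theorem mem_range_sumPermHom [Finite β] [Finite γ] {g : Perm α}
    (h : ∀ a, ∃ a', g (e (Sum.inl a)) = e (Sum.inl a')) : g ∈ (sumPermHom e).range := by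
  have hmem : (permCongrHom e).symm g ∈ (Perm.sumCongrHom γ β).range := by
    refine Perm.mem_sumCongrHom_range_of_perm_mapsTo_inl ?_
    rintro _ ⟨a, rfl⟩
    obtain ⟨a', ha'⟩ := h a
    exact ⟨a', (e.symm_apply_eq.2 ha').symm⟩
  obtain ⟨p, hp⟩ := hmem
  exact ⟨p, (congrArg (permCongrHom e) hp).trans (MulEquiv.apply_symm_apply _ g)⟩

theorem viaEmbeddingHom_eq_sumPermHom (he : ∀ a, e (Sum.inl a) = ι a) (π : Perm γ) :
    Perm.viaEmbeddingHom ι π = sumPermHom e (π, 1) := by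
  ext1 y
  obtain ⟨a | b, rfl⟩ := e.surjective y
  · rw [sumPermHom_apply_inl, he, he]
    exact Perm.viaEmbedding_apply π ι a
  · rw [sumPermHom_apply_inr]
    refine Perm.viaEmbedding_apply_of_notMem π ι _ ?_
    rintro ⟨a, ha⟩
    rw [← he, e.injective.eq_iff] at ha
    cases ha

theorem map_viaEmbeddingHom_eq (he : ∀ a, e (Sum.inl a) = ι a) (T : Subgroup (Perm γ)) :
    T.map (Perm.viaEmbeddingHom ι) = (T.prod ⊥).map (sumPermHom e) := by
  ext g
  constructor
  · rintro ⟨t, ht, rfl⟩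
    exact ⟨(t, 1), ⟨ht, rfl⟩, (viaEmbeddingHom_eq_sumPermHom he t).symm⟩
  · rintro ⟨⟨t, _⟩, ⟨ht, rfl⟩, rfl⟩
    exact ⟨t, ht, viaEmbeddingHom_eq_sumPermHom he t⟩

theorem apply_eq_of_mem_map_viaEmbeddingHom {T : Subgroup (Perm γ)} {g : Perm α}
    (hg : g ∈ T.map (Perm.viaEmbeddingHom ι)) {y : α} (hy : y ∉ Set.range ι) : g y = y := by
  obtain ⟨π, -, rfl⟩ := hg
  exact Perm.viaEmbedding_apply_of_notMem π ι y hy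

theorem exists_apply_eq_of_mem_normalizer {T : Subgroup (Perm γ)}
    (hT : ∀ a, ∃ t ∈ T, t a ≠ a) {g : Perm α}
    (hg : g ∈ Subgroup.normalizer (T.map (Perm.viaEmbeddingHom ι) : Set (Perm α))) (a : γ) :
    ∃ a', g (ι a) = ι a' := by
  obtain ⟨t, ht, hta⟩ := hT a
  have hconj := (Subgroup.mem_normalizer_iff.1 hg _).1 ⟨t, ht, rfl⟩
  by_contra! hrange
  have hfix := apply_eq_of_mem_map_viaEmbeddingHom hconj
    (y := g (ι a)) fun ⟨a', ha'⟩ => hrange a' ha'.symm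
  rw [Perm.mul_apply, Perm.mul_apply, Perm.inv_def, symm_apply_apply, g.injective.eq_iff] at hfix
  exact hta (ι.injective ((Perm.viaEmbedding_apply t ι a).symm.trans hfix))

theorem IsNormalizerComplement.map_viaEmbeddingHom [Finite β] [Finite γ] {K : Type*} [Group K]
    {j : K →* Perm γ} {T : Subgroup (Perm γ)} (h : IsNormalizerComplement j T)
    (hT : ∀ a, ∃ t ∈ T, t a ≠ a) (he : ∀ a, e (Sum.inl a) = ι a) :
    IsNormalizerComplement ((sumPermHom e).comp (j.prodMap (MonoidHom.id (Perm β))))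
      (T.map (Perm.viaEmbeddingHom ι)) := by
  have hrange : Subgroup.normalizer (T.map (Perm.viaEmbeddingHom ι) : Set (Perm α)) ≤
      (sumPermHom e).range := fun g hg => mem_range_sumPermHom fun a => by
    simpa only [he] using exists_apply_eq_of_mem_normalizer hT hg a
  rw [map_viaEmbeddingHom_eq he] at hrange ⊢
  exact (h.prodMap .id_bot).map_of_injective sumPermHom_injective hrange

variable [Fintype α] [Fintype γ]

theorem normalCore_map_viaEmbeddingHom (T : Subgroup (Perm γ))
    (hcard : Fintype.card γ < Fintype.card α) :
    (T.map (Perm.viaEmbeddingHom ι)).normalCore = ⊥ := by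
  obtain ⟨y, hy⟩ : ∃ y, y ∉ Set.range ι := by
    by_contra! hsurj
    exact hcard.not_ge (Fintype.card_le_of_surjective ι hsurj)
  exact normalCore_eq_bot_of_forall_apply_eq fun g hg => apply_eq_of_mem_map_viaEmbeddingHom hg hy

variable [DecidableEq α]

theorem card_support_le_of_mem_map_viaEmbeddingHom {T : Subgroup (Perm γ)} {g : Perm α}
    (hg : g ∈ T.map (Perm.viaEmbeddingHom ι)) : g.support.card ≤ Fintype.card γ := by
  have hsupport : g.support ⊆ Finset.univ.map ι := fun y hy => by
    by_contra hy'
    exact Perm.mem_support.1 hy (apply_eq_of_mem_map_viaEmbeddingHom hg (by simpa using hy'))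
  simpa using Finset.card_le_card hsupport

theorem map_viaEmbeddingHom_le_ker_sign [DecidableEq γ] {T : Subgroup (Perm γ)} :
    T.map (Perm.viaEmbeddingHom ι) ≤ Perm.sign.ker ↔ T ≤ Perm.sign.ker := by
  classical
  have hsign (π : Perm γ) : Perm.sign (Perm.viaEmbeddingHom ι π) = Perm.sign π :=
    @Perm.sign_extendDomain _ _ _ _ _ _ π _ (fun _ => Classical.propDecidable _) _
  rw [Subgroup.map_le_iff_le_comap, MonoidHom.comap_ker]
  exact forall₂_congr fun π _ => by
    rw [MonoidHom.mem_ker, MonoidHom.comp_apply, hsign, MonoidHom.mem_ker]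

end ViaEmbedding

/-! ### The four stabilisers -/

theorem map_conj_cubeTetrahedral_ne (g : Perm CubeFace) :
    cubeTetrahedral.map (MulAut.conj g).toMonoidHom ≠ cubeRotations := fun h =>
  not_cubeRotations_le_ker_sign
    (h ▸ (map_conj_le_iff_of_normal g).2 cubeTetrahedral_le_ker_sign)

section CubeStabilizer

variable {n : ℕ} (ι : CubeFace ↪ Fin n)

theorem card_cubeFace : Fintype.card CubeFace = 6 := by decide

theorem tetrahedralIn_le_ker_sign : tetrahedralIn ι ≤ Perm.sign.ker :=
  map_viaEmbeddingHom_le_ker_sign.2 cubeTetrahedral_le_ker_sign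

theorem not_rotationsIn_le_ker_sign : ¬ rotationsIn ι ≤ Perm.sign.ker := fun h =>
  not_cubeRotations_le_ker_sign (map_viaEmbeddingHom_le_ker_sign.1 h)

theorem map_conj_cubeStabilizer_ne {i i' : Fin 4} (hi : i ≠ i')
    (g : Perm (Fin n) × Perm (Fin n)) :
    (cubeStabilizer ι i).map (MulAut.conj g).toMonoidHom ≠ cubeStabilizer ι i' := fun h => by
  have hle (N : Subgroup (Perm (Fin n) × Perm (Fin n))) [N.Normal] :
      cubeStabilizer ι i' ≤ N ↔ cubeStabilizer ι i ≤ N := h ▸ map_conj_le_iff_of_normal g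
  have hfst := hle (Perm.sign.coprod 1).ker
  have hsnd := hle (MonoidHom.coprod 1 Perm.sign).ker
  have hA := tetrahedralIn_le_ker_sign ι
  have hB := not_rotationsIn_le_ker_sign ι
  revert hfst hsnd hi
  fin_cases i <;> fin_cases i' <;>
    simp [cubeStabilizer, prod_le_ker_coprod, hA, hB]

theorem exists_cubeStabilizer_eq (i : Fin 4) :
    ∃ T T' : Subgroup (Perm CubeFace), IsCubeGroup T ∧ IsCubeGroup T' ∧ cubeStabilizer ι i =
      (T.map (Perm.viaEmbeddingHom ι)).prod (T'.map (Perm.viaEmbeddingHom ι)) := by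
  have hP := isCubeGroup_cubeTetrahedral
  have hQ := isCubeGroup_cubeRotations
  fin_cases i
  exacts [⟨_, _, hQ, hQ, rfl⟩, ⟨_, _, hQ, hP, rfl⟩, ⟨_, _, hP, hQ, rfl⟩, ⟨_, _, hP, hP, rfl⟩]

theorem nonempty_cubeStabilizer_mulEquiv (i : Fin 4) :
    Nonempty (cubeStabilizer ι i ≃* Perm (Fin 4) × Perm (Fin 4)) := by
  obtain ⟨T, T', hT, hT', h⟩ := exists_cubeStabilizer_eq ι i
  obtain ⟨e⟩ := hT.nonempty_mulEquiv
  obtain ⟨e'⟩ := hT'.nonempty_mulEquiv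
  have φ (S : Subgroup (Perm CubeFace)) : S ≃* S.map (Perm.viaEmbeddingHom ι) :=
    Subgroup.equivMapOfInjective _ _ (Perm.viaEmbeddingHom_injective ι)
  rw [h]
  exact ⟨(Subgroup.prodEquiv _ _).trans
    (((φ T).symm.trans e).prodCongr ((φ T').symm.trans e'))⟩

theorem index_cubeStabilizer (hn : 4 ≤ n) (i : Fin 4) :
    (cubeStabilizer ι i).index = (n.factorial / Nat.factorial 4) ^ 2 := by
  obtain ⟨e⟩ := nonempty_cubeStabilizer_mulEquiv ι i
  have hlagrange := (cubeStabilizer ι i).card_mul_index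
  simp only [Nat.card_congr e.toEquiv, Nat.card_prod, Nat.card_perm, Nat.card_fin, ← sq]
    at hlagrange
  rw [Nat.div_pow (Nat.factorial_dvd_factorial hn), ← hlagrange,
    Nat.mul_div_cancel_left _ (by positivity)]

theorem normalCore_cubeStabilizer (hn : 6 < n) (i : Fin 4) :
    (cubeStabilizer ι i).normalCore = ⊥ := by
  obtain ⟨T, T', -, -, h⟩ := exists_cubeStabilizer_eq ι i
  have hcard : Fintype.card CubeFace < Fintype.card (Fin n) := by
    rwa [card_cubeFace, Fintype.card_fin]
  rw [h, normalCore_prod, normalCore_map_viaEmbeddingHom T hcard,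
    normalCore_map_viaEmbeddingHom T' hcard, Subgroup.bot_prod_bot]

theorem exists_isNormalizerComplement_cubeStabilizer (hn : 6 ≤ n) (i : Fin 4) :
    ∃ j : (ℤˣ × Perm (Fin (n - 6))) × (ℤˣ × Perm (Fin (n - 6))) →* Perm (Fin n) × Perm (Fin n),
      IsNormalizerComplement j (cubeStabilizer ι i) := by
  obtain ⟨T, T', hT, hT', h⟩ := exists_cubeStabilizer_eq ι i
  obtain ⟨e, he⟩ := exists_sumEquiv (β := Fin (n - 6)) ι (by
    rw [card_cubeFace, Fintype.card_fin, Fintype.card_fin, Nat.add_sub_cancel' hn])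
  rw [h]
  exact ⟨_, (hT.isNormalizerComplement.map_viaEmbeddingHom hT.exists_apply_ne he).prodMap
    (hT'.isNormalizerComplement.map_viaEmbeddingHom hT'.exists_apply_ne he)⟩

variable {m₀ m₁ : Perm (Fin n) × Perm (Fin n)} (hgen : Subgroup.closure {m₀, m₁} = ⊤)

theorem nonempty_edgeStabilizer_cubeStabilizer (hn : 6 < n) (i : Fin 4)
    (e : (Perm (Fin n) × Perm (Fin n)) ⧸ cubeStabilizer ι i) :
    Nonempty ((Dessin.ofCosets (cubeStabilizer ι i) m₀ m₁ hgen).edgeStabilizer e ≃*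
      Perm (Fin 4) × Perm (Fin 4)) := by
  obtain ⟨φ⟩ :=
    Dessin.nonempty_edgeStabilizer_mulEquiv hgen (normalCore_cubeStabilizer ι hn i) e
  obtain ⟨ψ⟩ := nonempty_cubeStabilizer_mulEquiv ι i
  exact ⟨φ.trans ψ⟩

theorem nonempty_automorphismGroup_cubeStabilizer (hn : 6 ≤ n) (i : Fin 4) :
    Nonempty ((Dessin.ofCosets (cubeStabilizer ι i) m₀ m₁ hgen).automorphismGroup ≃*
      (Perm (Fin 2) × Perm (Fin (n - 6))) × (Perm (Fin 2) × Perm (Fin (n - 6)))) := by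
  obtain ⟨j, hj⟩ := exists_isNormalizerComplement_cubeStabilizer ι hn i
  obtain ⟨φ⟩ := Dessin.nonempty_automorphismGroup_mulEquiv hgen hj
  let ψ : ℤˣ × Perm (Fin (n - 6)) ≃* Perm (Fin 2) × Perm (Fin (n - 6)) :=
    (MulEquiv.ofBijective Perm.sign (by decide)).symm.prodCongr (MulEquiv.refl _)
  exact ⟨φ.trans (ψ.prodCongr ψ)⟩

theorem IsAlmostFullCycleTriple.passport_cubeStabilizer {x y z : Perm (Fin n)}
    (h : IsAlmostFullCycleTriple x y z) (hn : 8 ≤ n) (i : Fin 4) :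
    (Dessin.ofCosets (cubeStabilizer ι i) (x, z) (y, x) h.closure_prod_eq_top).passport =
      (Multiset.replicate ((cubeStabilizer ι i).index / orderOf (x, z)) (orderOf (x, z)),
        Multiset.replicate ((cubeStabilizer ι i).index / orderOf (y, x)) (orderOf (y, x)),
        Multiset.replicate ((cubeStabilizer ι i).index / orderOf (z, y)) (orderOf (z, y))) := by
  obtain ⟨T, T', -, -, hTT'⟩ := exists_cubeStabilizer_eq ι i
  have hsupport (S : Subgroup (Perm CubeFace)) :
      ∀ τ ∈ S.map (Perm.viaEmbeddingHom ι), τ.support.card + 1 < Fintype.card (Fin n) :=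
    fun τ hτ => by
      have hle := card_support_le_of_mem_map_viaEmbeddingHom hτ
      rw [card_cubeFace] at hle
      rw [Fintype.card_fin]
      omega
  rw [hTT']
  exact h.passport_eq (hsupport T) (hsupport T')

end CubeStabilizer

theorem theorem1p2 :
    Nonempty (cubeTetrahedral ≃* Perm (Fin 4)) ∧ Nonempty (cubeRotations ≃* Perm (Fin 4)) ∧
    (∀ g : Perm CubeFace,
      cubeTetrahedral.map (MulAut.conj g).toMonoidHom ≠ cubeRotations) ∧
    ∀ (n : ℕ), 8 ≤ n → ∀ (ι : CubeFace ↪ Fin n),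
      ∃ (m₀ m₁ : Perm (Fin n) × Perm (Fin n)) (hgen : Subgroup.closure {m₀, m₁} = ⊤),
        let H : Fin 4 → Subgroup (Perm (Fin n) × Perm (Fin n)) := cubeStabilizer ι
        let D : (i : Fin 4) → Dessin ((Perm (Fin n) × Perm (Fin n)) ⧸ H i) :=
          fun i => Dessin.ofCosets (H i) m₀ m₁ hgen
        (∀ i j, i ≠ j → ∀ g : Perm (Fin n) × Perm (Fin n),
          (H i).map (MulAut.conj g).toMonoidHom ≠ H j) ∧
        (∀ i, (D i).degree = (n.factorial / Nat.factorial 4) ^ 2) ∧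
        (∀ i, (D i).IsUniform) ∧
        (∀ i j, (D i).type = (D j).type) ∧
        (∀ i j, (D i).passport = (D j).passport) ∧
        (∀ i, Nonempty ((D i).monodromyGroup ≃* Perm (Fin n) × Perm (Fin n))) ∧
        (∀ i e, Nonempty ((D i).edgeStabilizer e ≃* Perm (Fin 4) × Perm (Fin 4))) ∧
        (∀ i, Nonempty ((D i).automorphismGroup ≃*
          (Perm (Fin 2) × Perm (Fin (n - 6))) × (Perm (Fin 2) × Perm (Fin (n - 6))))) ∧
        (D 0).tot = 0 ∧ (D 1).tot = 1 ∧ (D 2).tot = 1 ∧ (D 3).tot = 3 ∧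
        (D 2).IsZOrientable ∧ ¬ (D 1).IsZOrientable := by
  refine ⟨isCubeGroup_cubeTetrahedral.nonempty_mulEquiv,
    isCubeGroup_cubeRotations.nonempty_mulEquiv, map_conj_cubeTetrahedral_ne, fun n hn ι => ?_⟩
  obtain ⟨x, y, z, h⟩ := exists_isAlmostFullCycleTriple (show 3 ≤ n by omega)
  have hgen := h.closure_prod_eq_top
  have hindex := index_cubeStabilizer ι (show 4 ≤ n by omega)
  have hpassport := h.passport_cubeStabilizer ι hn
  simp only [hindex] at hpassport
  have hpassport_eq := fun i j => (hpassport i).trans (hpassport j).symm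
  have hA := tetrahedralIn_le_ker_sign ι
  have hB := not_rotationsIn_le_ker_sign ι
  have htot (T T' : Subgroup (Perm (Fin n))) := Dessin.tot_ofCosets_prod T T' hgen
    h.sign_left h.sign_inv h.sign_right h.sign_left
  have horientable (T T' : Subgroup (Perm (Fin n))) :=
    Dessin.isZOrientable_ofCosets_prod T T' hgen h.sign_left h.sign_right
  refine ⟨(x, z), (y, x), hgen, fun i j hij g => map_conj_cubeStabilizer_ne ι hij g,
    hindex, fun i => Dessin.isUniform_of_passport (hpassport i),
    fun i j => Dessin.type_eq_of_passport_eq (hpassport_eq i j), hpassport_eq,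
    fun i => ⟨(Dessin.monodromyEquiv hgen (normalCore_cubeStabilizer ι (by omega) i)).symm⟩,
    nonempty_edgeStabilizer_cubeStabilizer ι hgen (by omega),
    nonempty_automorphismGroup_cubeStabilizer ι hgen (by omega),
    (htot _ _).trans ?_, (htot _ _).trans ?_, (htot _ _).trans ?_, (htot _ _).trans ?_,
    (horientable _ _).2 hA, mt (horientable _ _).1 hB⟩ <;>
  simp [hA, hB]
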